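/- Let $G=(V,E)$ be a finite simple graph of maximum degree $d$. Attach to each vertex $v$ a finite-dimensional Hilbert space $\mathcal H_v$, and let $\mathcal H=\bigotimes_{v\in V}\mathcal H_v$. An operator acts on $X\subseteq V$ if it has the form $O\otimes\mathbb 1_{V\setminus X}$, and $\|\cdot\|$ is the operator norm. Let $$H(t)=\sum_{v\in V}\Phi_1(v,t)+\sum_{e\in E}\Phi_2(e,t),\qquad t\ge 0,$$ where $\Phi_1(v,t)$ and $\Phi_2(e,t)$ are Hermitian, measurable in $t$, act on $\{v\}$ and on the two ends of $e$ respectively, and satisfy $\|\Phi_1(v,t)\|\le B$, $\|\Phi_2(e,t)\|\le J$ with $J\ge0$. Let $U_t$ be the time-evolution operator: the continuous solution of $U_t=\mathbb 1-i\int_0^t H(s)U_s\,ds$. For a unitary $T$ and disjoint $X,Y\subseteq V$, let the Lieb–Robinson coefficient $c_T(X,Y)$ be the least $c\ge0$ such that $\|[TO_XT^\dagger,O_Y]\|\le c\,\|O_X\|\,\|O_Y\|$ for all operators $O_X,O_Y$ acting on $X,Y$ (this minimum is attained). Let $t\ge0$ and let $T$ be either $U_t$ or $U_t^\dagger$; write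 $c_t=c_T$. For density operators, $F(\rho,\sigma)=\operatorname{tr}\sqrt{\sqrt\sigma\,\rho\,\sqrt\sigma}$, and $\operatorname{tr}_{\bar Y}$ is the partial trace over $V\setminus Y$. Let $\mathrm{dist}$ be the graph distance, $\mathrm{dist}(X,Y)=\min_{x\in X,y\in Y}\mathrm{dist}(x,y)$ (with value $\infty$ if no $x\in X$ is connected to any $y\in Y$), $\mathrm{diam}(X)=\max_{x,x'\in X}\mathrm{dist}(x,x')$, and let $N(n)$ be the number of walks of length $n$ in $G$ that start in $X$ and end in $Y$. 1. (Arbitrary graph.) If $R$ is a natural number with $\mathrm{dist}(X,Y)\ge R$, then $$c_t(X,Y)\le 2\sum_{n=R}^\infty\frac{(2Jt)^n}{n!}N(n)\le 2|X|\,e^{2edJt-R},$$ where the series converges. For every density operator $\rho$ on $\mathcal H$ and every unitary $A$ acting on $X$, $$F\bigl(\operatorname{tr}_{\bar Y}T\rho T^\dagger,\ \operatorname{tr}_{\bar Y}TA\rho A^\dagger T^\dagger\bigr)\ \ge\ 1-2|X|\,e^{2edJt-R}\,\|A\|.$$ 2. (Linear chain.) If $G$ is a path, $\mathrm{dist}(X,Y)=R$,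 $\mathrm{diam}(X)<R$ and $\mathrm{diam}(Y)<R$, then $$c_t(X,Y)\le 2\sum_{\substack{n\ge R\\ n\equiv R\ (\mathrm{mod}\ 2)}}\frac{(2Jt)^n}{n!}\binom{n}{\frac{n+R}{2}}=2I_R(4Jt),$$ where $I_R(x)=\sum_{k\ge0}\frac{(x/2)^{2k+R}}{k!\,(k+R)!}$ is the modified Bessel function of the first kind. For every density operator $\rho$ on $\mathcal H$ and every unitary $A$ acting on $X$, $$F\bigl(\operatorname{tr}_{\bar Y}T\rho T^\dagger,\ \operatorname{tr}_{\bar Y}TA\rho A^\dagger T^\dagger\bigr)\ \ge\ 1-2I_R(4Jt)\,\|A\|.$$ -/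

import Mathlib

open scoped Matrix Matrix.Norms.L2Operator MatrixOrder ComplexOrder Nat

namespace SpinGraph

section Regions

variable {V : Type*} [Fintype V] [DecidableEq V]

/-- The graph distance between two regions, `dist(X,Y) = min_{x ∈ X, y ∈ Y} dist(x,y)`;
it is `⊤` if no vertex of `X` is connected to a vertex of `Y`. -/
noncomputable def regionDist (G : SimpleGraph V) (X Y : Finset V) : ℕ∞ :=
  ⨅ x ∈ X, ⨅ y ∈ Y, G.edist x y

/-- The diameter of a region with respect to the graph distance. -/
noncomputable def regionDiam (G : SimpleGraph V) (X : Finset V) : ℕ∞ :=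
  ⨆ x ∈ X, ⨆ y ∈ X, G.edist x y

/-- `N(n)`: the number of lattice paths (walks) of length `n` starting in `X` and ending in `Y`. -/
noncomputable def pathCount (G : SimpleGraph V) (X Y : Finset V) (n : ℕ) : ℕ :=
  ∑ x ∈ X, ∑ y ∈ Y, {p : G.Walk x y | p.length = n}.ncard

/-- `G` is a linear chain `0 - 1 - ⋯ - (L-1)`. -/
def IsLinearChain (G : SimpleGraph V) : Prop :=
  ∃ L : ℕ, Nonempty (G ≃g SimpleGraph.pathGraph L)

end Regions

section Operators

variable {V : Type*} [Fintype V] [DecidableEq V]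

/-- The Hilbert space of the vertex `v` has the orthonormal basis `κ v`; the tensor product over a
region `X` has the orthonormal basis `Config κ X` of configurations on `X`. -/
abbrev Config (κ : V → Type*) (X : Finset V) : Type _ := ∀ v : X, κ v

/-- Operators on the Hilbert space of the full system, as matrices in the product basis. The norm
on them is the operator norm. -/
abbrev Op (κ : V → Type*) : Type _ := Matrix (∀ v, κ v) (∀ v, κ v) ℂ

variable {κ : V → Type*} [∀ v, Fintype (κ v)] [∀ v, DecidableEq (κ v)]

/-- The operator `A ⊗ 1` on the full system, for `A` an operator on the region `X`. -/
def embed (X : Finset V) (A : Matrix (Config κ X) (Config κ X) ℂ) : Op κ :=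
  fun σ τ => if ∀ v, v ∉ X → σ v = τ v then A (fun v => σ v) (fun v => τ v) else 0

/-- `M` is an operator acting on the region `X`. -/
def ActsOn (X : Finset V) (M : Op κ) : Prop :=
  ∃ A : Matrix (Config κ X) (Config κ X) ℂ, M = embed X A

/-- The partial trace over the complement of `Y`. -/
def reduced (Y : Finset V) (M : Op κ) : Matrix (Config κ Y) (Config κ Y) ℂ :=
  fun a b => ∑ σ : ∀ v, κ v, ∑ τ : ∀ v, κ v,
    if (∀ v : Y, σ v = a v) ∧ (∀ v : Y, τ v = b v) ∧ (∀ v, v ∉ Y → σ v = τ v) then M σ τ else 0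

/-- The scalar `c` satisfies `‖[T O_X T†, O_Y]‖ ≤ c ‖O_X‖ ‖O_Y‖` for all operators `O_X`, `O_Y`
acting on `X` and `Y`. -/
def IsCommutatorBound (T : Op κ) (X Y : Finset V) (c : ℝ) : Prop :=
  ∀ A B : Op κ, ActsOn X A → ActsOn Y B → ‖⁅T * A * Tᴴ, B⁆‖ ≤ c * ‖A‖ * ‖B‖

/-- The Lieb–Robinson coefficient `c_T(X,Y)`: the least nonnegative commutator bound. -/
noncomputable def lrCoeff (T : Op κ) (X Y : Finset V) : ℝ :=
  sInf {c : ℝ | 0 ≤ c ∧ IsCommutatorBound T X Y c}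

/-- A local Hamiltonian `H(t) = ∑_v Φ₁(v,t) + ∑_e Φ₂(e,t)` on the graph `G`, with
`‖Φ₁(v,t)‖ ≤ B` and `‖Φ₂(e,t)‖ ≤ J` at all times `t ≥ 0`. -/
structure LocalHamiltonian (G : SimpleGraph V) [DecidableRel G.Adj]
    (κ : V → Type*) [∀ v, Fintype (κ v)] [∀ v, DecidableEq (κ v)] (B J : ℝ) where
  Φ₁ : V → ℝ → Op κ
  Φ₂ : Sym2 V → ℝ → Op κ
  measurable₁ : ∀ v σ τ, Measurable fun t => Φ₁ v t σ τ
  measurable₂ : ∀ e ∈ G.edgeFinset, ∀ σ τ, Measurable fun t => Φ₂ e t σ τ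
  hermitian₁ : ∀ v, ∀ t ≥ 0, (Φ₁ v t).IsHermitian
  hermitian₂ : ∀ e ∈ G.edgeFinset, ∀ t ≥ 0, (Φ₂ e t).IsHermitian
  actsOn₁ : ∀ v, ∀ t ≥ 0, ActsOn {v} (Φ₁ v t)
  actsOn₂ : ∀ e ∈ G.edgeFinset, ∀ t ≥ 0, ActsOn e.toFinset (Φ₂ e t)
  norm_le₁ : ∀ v, ∀ t ≥ 0, ‖Φ₁ v t‖ ≤ B
  norm_le₂ : ∀ e ∈ G.edgeFinset, ∀ t ≥ 0, ‖Φ₂ e t‖ ≤ J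

/-- The operator `H(t)`. -/
noncomputable def LocalHamiltonian.H {G : SimpleGraph V} [DecidableRel G.Adj] {B J : ℝ}
    (h : LocalHamiltonian G κ B J) (t : ℝ) : Op κ :=
  ∑ v, h.Φ₁ v t + ∑ e ∈ G.edgeFinset, h.Φ₂ e t

/-- `U` is the time-evolution operator generated by `H` on `t ≥ 0`, that is, the continuous solution
of the Schrödinger equation `i U' = H(t) U`, `U(0) = 1`, in its integrated form (which allows
Hamiltonians that are discontinuous in time). -/
def IsEvolution (H U : ℝ → Op κ) : Prop :=
  ContinuousOn U (Set.Ici 0) ∧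
    ∀ t ≥ 0, U t = 1 - Complex.I • ∫ s in (0 : ℝ)..t, H s * U s

/-- `ρ` is a density operator. -/
def IsDensity {ι : Type*} [Fintype ι] (ρ : Matrix ι ι ℂ) : Prop :=
  ρ.PosSemidef ∧ ρ.trace = 1

/-- The fidelity `F(ρ,σ) = tr √(√σ ρ √σ)`. -/
noncomputable def fidelity {ι : Type*} [Fintype ι] [DecidableEq ι] (ρ σ : Matrix ι ι ℂ) : ℝ :=
  (Matrix.trace (CFC.sqrt (CFC.sqrt σ * ρ * CFC.sqrt σ))).re

end Operators

/-- The modified Bessel function of the first kind `I_n(x)` of integer order `n ≥ 0`. -/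
noncomputable def besselI (n : ℕ) (x : ℝ) : ℝ :=
  ∑' k : ℕ, (x / 2) ^ (2 * k + n) / ((k ! : ℝ) * ((k + n)! : ℝ))

end SpinGraph

/-! The proof removes interaction terms region by region. If all terms touching a region `S` are
dropped from the Hamiltonian, every operator on `S` is conserved, and it commutes with the evolution
of any `b` on a disjoint `Y`. Take `S ⊆ S'` and `a` acting on `S'`, and compare the dynamics outside
`S` with the dynamics outside `S'`. By Duhamel (`norm_commutator_le_of_generators`), the commutator
of `a` with the evolved `b` is at most `2‖a‖` times the time integral of the commutator of the
omitted terms with `b` evolved outside `S'`. Omitted terms supported in `S'` drop out, among them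
all on-site terms, so `B` never enters. What remains are bonds from `x ∈ S' \ S` to `z ∉ S'`, of
norm at most `J` and acting on `S' ∪ {z}`: the same problem with `S'` in place of `S`
(`IsEvolution.norm_commutator_le`).

Starting from `S = ∅`, `S' = X` and then adding one vertex at a time, the recursion traces
self-avoiding walks and ends with the trivial bound `2‖a‖‖b‖` on reaching `Y`. Each step costs a
factor `2J` and a time integration, so a walk of length `n` contributes `(2Jt)^n / n!`. Forgetting
self-avoidance gives `N(n)`, which vanishes below `R` and is at most `|X| d^n`; since `1 ≤ e^(n-R)`
for `n ≥ R`, the tail is at most `|X|` times an exponential. On a chain, `X` may be enlarged to the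
half-line behind its vertex nearest to `Y`. A single self-avoiding walk is then left, and its term
`(2Jt)^R / R!` is already the leading term of the Bessel series.

Inverting `T` exchanges the roles of `X` and `Y`, which settles the other picture. For the fidelity,
the Powers–Størmer inequality gives `1 - F ≤ tr S(ρ - σ) / 2` for a sign observable `S`. Placed on
`Y`, its expectation changes under `Q = T A T†` by `tr ρ' Q†[Q, S]`, which the commutator bound
controls. -/

namespace SpinGraph

section Analysis

open MeasureTheory Set Filter Topology

/-! ### Calculus of Lipschitz functions differentiable almost everywhere -/

section Lipschitz

variable {A : Type*} [NormedAddCommGroup A] [NormedSpace ℝ A]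

/-- `F` is Lipschitz on `[a, b]`, with derivative `f` at almost every point. -/
structure HasLipDeriv (F f : ℝ → A) (a b : ℝ) : Prop where
  lip : ∃ K : NNReal, LipschitzOnWith K F (Icc a b)
  deriv : ∀ᵐ x, x ∈ Ioo a b → HasDerivAt F (f x) x

theorem ae_ne (a : ℝ) : ∀ᵐ x : ℝ, x ≠ a := by simp [ae_iff, measure_singleton]

namespace HasLipDeriv

variable {F G f g : ℝ → A} {a b : ℝ}

theorem mono (h : HasLipDeriv F f a b) {c d : ℝ} (hc : a ≤ c) (hd : d ≤ b) :
    HasLipDeriv F f c d := by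
  obtain ⟨K, hK⟩ := h.lip
  refine ⟨⟨K, hK.mono (Icc_subset_Icc hc hd)⟩, ?_⟩
  filter_upwards [h.deriv] with x hx hx'
  exact hx (Ioo_subset_Ioo hc hd hx')

theorem congr_deriv (h : HasLipDeriv F f a b) (hfg : ∀ x ∈ Ioo a b, f x = g x) :
    HasLipDeriv F g a b := by
  refine ⟨h.lip, ?_⟩
  filter_upwards [h.deriv] with x hx hx'
  exact hfg x hx' ▸ hx hx'

theorem const (c : A) : HasLipDeriv (fun _ => c) (fun _ => 0) a b :=
  ⟨⟨0, LipschitzWith.const c |>.lipschitzOnWith⟩, .of_forall fun x _ => hasDerivAt_const x c⟩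

theorem sub (hF : HasLipDeriv F f a b) (hG : HasLipDeriv G g a b) :
    HasLipDeriv (fun x => F x - G x) (fun x => f x - g x) a b := by
  obtain ⟨K, hK⟩ := hF.lip
  obtain ⟨L, hL⟩ := hG.lip
  refine ⟨⟨K + L, hK.sub hL⟩, ?_⟩
  filter_upwards [hF.deriv, hG.deriv] with x hx hy h
  exact (hx h).sub (hy h)

theorem clm {A' : Type*} [NormedAddCommGroup A'] [NormedSpace ℝ A'] (L : A →L[ℝ] A')
    (hF : HasLipDeriv F f a b) :
    HasLipDeriv (fun x => L (F x)) (fun x => L (f x)) a b := by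
  obtain ⟨K, hK⟩ := hF.lip
  refine ⟨⟨_, L.lipschitz.comp_lipschitzOnWith hK⟩, ?_⟩
  filter_upwards [hF.deriv] with x hx h
  exact L.hasFDerivAt.comp_hasDerivAt x (hx h)

theorem ac (h : HasLipDeriv F f a b) (hab : a ≤ b) : AbsolutelyContinuousOnInterval F a b := by
  obtain ⟨K, hK⟩ := h.lip
  exact LipschitzOnWith.absolutelyContinuousOnInterval (by rwa [uIcc_of_le hab])

theorem eq_of_deriv_zero (h : HasLipDeriv F (fun _ => 0) a b) (hab : a ≤ b) : F b = F a := by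
  obtain ⟨C, hC⟩ := (h.ac hab).const_of_ae_hasDerivAt_zero (by
    rw [uIcc_of_le hab]
    filter_upwards [h.deriv, ae_ne a, ae_ne b] with x hx ha hb hx'
    exact hx ⟨lt_of_le_of_ne hx'.1 ha.symm, lt_of_le_of_ne hx'.2 hb⟩)
  rw [hC b right_mem_uIcc, hC a left_mem_uIcc]

theorem of_integral [CompleteSpace A] {M : ℝ}
    (hf : AEStronglyMeasurable f volume)
    (hM : ∀ᵐ x, x ∈ Ioo a b → ‖f x‖ ≤ M) (hab : a ≤ b) :
    HasLipDeriv (fun x => ∫ s in a..x, f s) f a b := by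
  have hM' : ∀ᵐ x, x ∈ Icc a b → ‖f x‖ ≤ M := by
    filter_upwards [hM, ae_ne a, ae_ne b] with x hx ha hb hx'
    exact hx ⟨lt_of_le_of_ne hx'.1 ha.symm, lt_of_le_of_ne hx'.2 hb⟩
  have hint : IntegrableOn f (Icc a b) := by
    refine Measure.integrableOn_of_bounded (M := M) (by simp) hf ?_
    rwa [ae_restrict_iff' measurableSet_Icc]
  have hii : ∀ x ∈ Icc a b, ∀ y ∈ Icc a b, IntervalIntegrable f volume x y := by
    intro x hx y hy
    refine (hint.mono_set ?_).intervalIntegrable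
    exact (convex_Icc a b).ordConnected.uIcc_subset hx hy
  refine ⟨⟨M.toNNReal, LipschitzOnWith.of_dist_le_mul fun x hx y hy => ?_⟩, ?_⟩
  · have ha : a ∈ Icc a b := left_mem_Icc.2 hab
    rw [dist_eq_norm, intervalIntegral.integral_interval_sub_left (hii a ha x hx) (hii a ha y hy)]
    rw [Real.dist_eq]
    refine intervalIntegral.norm_integral_le_of_norm_le_const_ae ?_
    filter_upwards [hM'] with s hs hs'
    refine (hs ?_).trans (Real.le_coe_toNNReal M)
    exact (convex_Icc a b).ordConnected.uIcc_subset hy hx (uIoc_subset_uIcc hs')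
  · filter_upwards [(hii a (left_mem_Icc.2 hab) b (right_mem_Icc.2 hab)).ae_hasDerivAt_integral]
      with x hx hx'
    exact hx (by rw [uIcc_of_le hab]; exact Ioo_subset_Icc_self hx') a left_mem_uIcc

/-- Nothing is known about the measurability of `f`, so the fundamental theorem is applied to the
derivative function of `F`, which is measurable and bounded by the Lipschitz constant. `F` minus the
integral of this function has derivative zero almost everywhere, hence is constant by absolute
continuity. -/
theorem norm_sub_le [CompleteSpace A] (h : HasLipDeriv F f a b) (hab : a ≤ b) {g : ℝ → ℝ}
    (hg : IntervalIntegrable g volume a b) (hfg : ∀ x ∈ Ioo a b, ‖f x‖ ≤ g x) :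
    ‖F b - F a‖ ≤ ∫ x in a..b, g x := by
  obtain ⟨K, hK⟩ := h.lip
  have hd : HasLipDeriv (fun x => ∫ s in a..x, _root_.deriv F s) (_root_.deriv F) a b := by
    refine of_integral (M := K) (aestronglyMeasurable_deriv _ _) ?_ hab
    exact .of_forall fun x hx => norm_deriv_le_of_lipschitzOn (Icc_mem_nhds hx.1 hx.2) hK
  have hF : HasLipDeriv F (_root_.deriv F) a b := by
    refine ⟨h.lip, ?_⟩
    filter_upwards [h.deriv] with x hx hx'
    exact (hx hx').differentiableAt.hasDerivAt
  have := ((hF.sub hd).congr_deriv (g := fun _ => 0) (by simp)).eq_of_deriv_zero hab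
  simp only [intervalIntegral.integral_same, sub_zero] at this
  rw [← this, sub_sub_cancel]
  refine intervalIntegral.norm_integral_le_of_norm_le hab ?_ hg
  filter_upwards [h.deriv, ae_ne b] with x hx hb hx'
  have hx'' : x ∈ Ioo a b := ⟨hx'.1, lt_of_le_of_ne hx'.2 hb⟩
  rw [(hx hx'').deriv]
  exact hfg x hx''

end HasLipDeriv

theorem HasLipDeriv.mul {A : Type*} [NormedRing A] [NormedAlgebra ℝ A] {F G f g : ℝ → A}
    {a b : ℝ} (hF : HasLipDeriv F f a b) (hG : HasLipDeriv G g a b) :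
    HasLipDeriv (fun x => F x * G x) (fun x => f x * G x + F x * g x) a b := by
  obtain ⟨K, hK⟩ := hF.lip
  obtain ⟨L, hL⟩ := hG.lip
  obtain ⟨C, hC⟩ := isCompact_Icc.exists_bound_of_continuousOn hK.continuousOn
  obtain ⟨D, hD⟩ := isCompact_Icc.exists_bound_of_continuousOn hL.continuousOn
  refine ⟨⟨C.toNNReal * L + K * D.toNNReal, LipschitzOnWith.of_dist_le_mul fun x hx y hy => ?_⟩, ?_⟩
  · have e : F x * G x - F y * G y = F x * (G x - G y) + (F x - F y) * G y := by noncomm_ring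
    have h1 := hK.dist_le_mul x hx y hy
    have h2 := hL.dist_le_mul x hx y hy
    have hC' := (hC x hx).trans (Real.le_coe_toNNReal C)
    have hD' := (hD y hy).trans (Real.le_coe_toNNReal D)
    rw [dist_eq_norm] at h1 h2
    rw [dist_eq_norm, e]
    calc _ ≤ ‖F x‖ * ‖G x - G y‖ + ‖F x - F y‖ * ‖G y‖ :=
          (norm_add_le _ _).trans (add_le_add (norm_mul_le _ _) (norm_mul_le _ _))
      _ ≤ C.toNNReal * (L * dist x y) + (K * dist x y) * D.toNNReal := by gcongr
      _ = _ := by push_cast; ring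
  · filter_upwards [hF.deriv, hG.deriv] with x hx hy h
    exact (hx h).mul (hy h)

end Lipschitz

/-! ### Evolution equations with measurable generators, and Duhamel's formula -/

section Evolution

/-- A measurable, bounded, self-adjoint generator on `t ≥ 0`. -/
structure IsGenerator {A : Type*} [NormedRing A] [StarRing A] (H : ℝ → A) (M : ℝ) : Prop where
  meas : StronglyMeasurable H
  bound : ∀ t ≥ 0, ‖H t‖ ≤ M
  star_eq : ∀ t ≥ 0, star (H t) = H t

variable {A : Type*} [NormedRing A] [NormedAlgebra ℂ A]

/-- The Picard iterates of the equation `U(t) = 1 - i ∫₀ᵗ H U`. -/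
noncomputable def picard (H : ℝ → A) : ℕ → ℝ → A
  | 0, _ => 1
  | n + 1, t => -(Complex.I • ∫ s in (0 : ℝ)..t, H s * picard H n s)

theorem continuous_picard {H : ℝ → A} (hH : StronglyMeasurable H) {M : ℝ}
    (hM : ∀ t, ‖H t‖ ≤ M) (n : ℕ) : Continuous (picard H n) := by
  induction n with
  | zero => exact continuous_const
  | succ n ih =>
    refine (Continuous.const_smul ?_ _).neg
    refine intervalIntegral.continuous_primitive (fun a b => ?_) 0
    have h1 : IntervalIntegrable H volume a b :=
      (intervalIntegrable_const (c := M)).mono_fun hH.aestronglyMeasurable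
        (.of_forall fun t => (hM t).trans (Real.le_norm_self M))
    exact h1.mul_continuousOn ih.continuousOn

theorem norm_picard_le {H : ℝ → A} {M : ℝ} (hM : ∀ t, ‖H t‖ ≤ M) (n : ℕ) {t : ℝ} (ht : 0 ≤ t) :
    ‖picard H n t‖ ≤ ‖(1 : A)‖ * (M * t) ^ n / n ! := by
  have hM0 : 0 ≤ M := (norm_nonneg _).trans (hM 0)
  induction n generalizing t with
  | zero => simp [picard]
  | succ n ih =>
    rw [picard, norm_neg, norm_smul, Complex.norm_I, one_mul]
    calc _ ≤ ∫ s in (0 : ℝ)..t, M * (‖(1 : A)‖ * (M * s) ^ n / n !) := by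
          refine intervalIntegral.norm_integral_le_of_norm_le ht (.of_forall fun s hs => ?_)
            (Continuous.intervalIntegrable (by fun_prop) _ _)
          exact (norm_mul_le _ _).trans (mul_le_mul (hM s) (ih hs.1.le) (norm_nonneg _) hM0)
      _ = _ := by
          have : ∀ s : ℝ, M * (‖(1 : A)‖ * (M * s) ^ n / n !)
              = (‖(1 : A)‖ * M ^ (n + 1) / n !) * s ^ n := fun s => by ring
          simp_rw [this]
          rw [intervalIntegral.integral_const_mul, integral_pow, Nat.factorial_succ]
          push_cast
          field_simp
          ring

theorem norm_mul_mul_star_of_mem_unitary {A : Type*} [NormedRing A] [StarRing A] [CStarRing A]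
    {u : A} (hu : u ∈ unitary A) (a : A) :
    ‖u * a * star u‖ = ‖a‖ := by
  rw [CStarRing.norm_mul_mem_unitary _ (Unitary.star_mem hu), CStarRing.norm_mem_unitary_mul _ hu]

theorem HasLipDeriv.star {A : Type*} [NormedRing A] [NormedAlgebra ℂ A] [StarRing A] [CStarRing A]
    [StarModule ℂ A] {F f : ℝ → A} {a b : ℝ} (h : HasLipDeriv F f a b) :
    HasLipDeriv (fun x => Star.star (F x)) (fun x => Star.star (f x)) a b :=
  h.clm ((starL' ℝ : A ≃L[ℝ] A) : A →L[ℝ] A)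

theorem evolution_zero {H U : ℝ → A}
    (he : ∀ t ≥ 0, U t = 1 - Complex.I • ∫ s in (0 : ℝ)..t, H s * U s) : U 0 = 1 := by
  simp [he 0 le_rfl]

variable [CompleteSpace A]

theorem exists_evolution_of_bounded {H : ℝ → A} (hH : StronglyMeasurable H) {M : ℝ}
    (hM : ∀ t, ‖H t‖ ≤ M) :
    ∃ U : ℝ → A, ContinuousOn U (Ici 0) ∧
      ∀ t ≥ 0, U t = 1 - Complex.I • ∫ s in (0 : ℝ)..t, H s * U s := by
  have hM0 : 0 ≤ M := (norm_nonneg _).trans (hM 0)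
  have hsum : ∀ t : ℝ, Summable fun n : ℕ => ‖(1 : A)‖ * (M * t) ^ n / n ! := fun t => by
    simp_rw [mul_div_assoc]
    exact (Real.summable_pow_div_factorial _).mul_left _
  have hle : ∀ {n : ℕ} {s t : ℝ}, 0 ≤ s → s ≤ t →
      ‖picard H n s‖ ≤ ‖(1 : A)‖ * (M * t) ^ n / n ! := fun hs hst =>
    (norm_picard_le hM _ hs).trans (by gcongr)
  have hcont : ContinuousOn (fun t => ∑' n, picard H n t) (Ici 0) := by
    intro t (ht : 0 ≤ t)
    have h1 : ContinuousOn (fun t => ∑' n, picard H n t) (Icc 0 (t + 1)) :=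
      continuousOn_tsum (fun n => (continuous_picard hH hM n).continuousOn) (hsum (t + 1))
        fun n x hx => hle hx.1 hx.2
    refine (h1 t ⟨ht, by linarith⟩).mono_of_mem_nhdsWithin ?_
    filter_upwards [self_mem_nhdsWithin, mem_nhdsWithin_of_mem_nhds
      (Iic_mem_nhds (show t < t + 1 by linarith))] with x hx hy using ⟨hx, hy⟩
  refine ⟨_, hcont, fun t ht => ?_⟩
  have hs : ∀ s, 0 ≤ s → Summable fun n => picard H n s := fun s hs =>
    .of_norm_bounded (hsum s) fun n => norm_picard_le hM n hs
  have key : HasSum (fun n => ∫ s in (0 : ℝ)..t, H s * picard H n s)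
      (∫ s in (0 : ℝ)..t, H s * ∑' n, picard H n s) := by
    refine intervalIntegral.hasSum_integral_of_dominated_convergence
      (fun n _ => M * (‖(1 : A)‖ * (M * t) ^ n / n !)) (fun n => ?_) (fun n => ?_)
      (.of_forall fun s _ => (hsum t).mul_left M) intervalIntegrable_const
      (.of_forall fun s hs' => ?_)
    · exact hH.aestronglyMeasurable.mul (continuous_picard hH hM n).aestronglyMeasurable
    · refine .of_forall fun s hs => ?_
      rw [uIoc_of_le ht] at hs
      exact (norm_mul_le _ _).trans (mul_le_mul (hM s) (hle hs.1.le hs.2) (norm_nonneg _) hM0)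
    · rw [uIoc_of_le ht] at hs'
      exact (hs s hs'.1.le).hasSum.mul_left (H s)
  have h0 := (hs t ht).tsum_eq_zero_add
  simp only [picard] at h0
  rw [h0, tsum_neg, (key.const_smul Complex.I).tsum_eq, sub_eq_add_neg]

/-- Only the full evolution is given; the evolutions of the truncated Hamiltonians have to be
constructed. The generator is bounded for `t ≥ 0` only, hence the extension by zero. -/
theorem exists_evolution [StarRing A] {H : ℝ → A} {M : ℝ} (hH : IsGenerator H M) :
    ∃ U : ℝ → A, ContinuousOn U (Ici 0) ∧
      ∀ t ≥ 0, U t = 1 - Complex.I • ∫ s in (0 : ℝ)..t, H s * U s := by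
  have hM0 : 0 ≤ M := (norm_nonneg _).trans (hH.bound 0 le_rfl)
  obtain ⟨U, hU, hU'⟩ := exists_evolution_of_bounded (H := (Ici 0).indicator H) (M := M)
    (hH.meas.indicator measurableSet_Ici) (fun t => by
      by_cases ht : t ∈ Ici (0 : ℝ)
      · rw [indicator_of_mem ht]; exact hH.bound t ht
      · rw [indicator_of_notMem ht]; simpa)
  refine ⟨U, hU, fun t ht => ?_⟩
  rw [hU' t ht]
  congr 2
  refine intervalIntegral.integral_congr fun s hs => ?_
  rw [uIcc_of_le ht] at hs
  simp only [indicator_of_mem (show s ∈ Ici (0 : ℝ) from hs.1)]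

variable [StarRing A] {H K : ℝ → A} {M N : ℝ}
  {U V : ℝ → A}

theorem IsGenerator.hasLipDeriv (hH : IsGenerator H M) (hc : ContinuousOn U (Ici 0))
    (he : ∀ t ≥ 0, U t = 1 - Complex.I • ∫ s in (0 : ℝ)..t, H s * U s) {t : ℝ} (ht : 0 ≤ t) :
    HasLipDeriv U (fun s => -(Complex.I • (H s * U s))) 0 t := by
  obtain ⟨C, hC⟩ := isCompact_Icc.exists_bound_of_continuousOn (s := Icc 0 t)
    (hc.mono Icc_subset_Ici_self)
  -- `U` is unconstrained at negative times; freezing it there makes the integrand measurable on the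
  -- whole line.
  let W : ℝ → A := fun s => U (max 0 s)
  have hW : Continuous W := hc.comp_continuous (by fun_prop) fun s => mem_Ici.2 (le_max_left _ _)
  have hWU : ∀ s, 0 ≤ s → W s = U s := fun s hs => by simp [W, hs]
  have h1 : HasLipDeriv (fun x => ∫ s in (0 : ℝ)..x, H s * W s) (fun s => H s * W s) 0 t := by
    refine .of_integral (M := M * C) (hH.meas.aestronglyMeasurable.mul hW.aestronglyMeasurable)
      (.of_forall fun s hs => ?_) ht
    rw [hWU s hs.1.le]
    exact (norm_mul_le _ _).trans (mul_le_mul (hH.bound s hs.1.le) (hC s ⟨hs.1.le, hs.2.le⟩)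
      (norm_nonneg _) ((norm_nonneg _).trans (hH.bound s hs.1.le)))
  have h2 := (HasLipDeriv.const (a := 0) (b := t) (1 : A)).sub
    (h1.clm ((Complex.I • ContinuousLinearMap.id ℂ A).restrictScalars ℝ))
  have he' : ∀ x, 0 ≤ x → 1 - Complex.I • (∫ s in (0 : ℝ)..x, H s * W s) = U x := fun x hx => by
    rw [he x hx]
    congr 2
    refine intervalIntegral.integral_congr fun s hs => ?_
    rw [uIcc_of_le hx] at hs
    simp only [hWU s hs.1]
  obtain ⟨K, hK⟩ := h2.lip
  refine ⟨⟨K, fun x hx y hy => ?_⟩, ?_⟩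
  · rw [← he' x hx.1, ← he' y hy.1]
    exact hK hx hy
  · filter_upwards [h2.deriv] with x hx hx'
    have h3 := hx hx'
    simp only [ContinuousLinearMap.coe_restrictScalars', smul_apply,
      ContinuousLinearMap.id_apply, zero_sub, hWU x hx'.1.le] at h3
    refine h3.congr_of_eventuallyEq ?_
    filter_upwards [Ioi_mem_nhds hx'.1] with y hy
    exact (he' y (le_of_lt hy)).symm

variable [CStarRing A] [StarModule ℂ A]

theorem IsGenerator.hasLipDeriv_star (hH : IsGenerator H M) (hc : ContinuousOn U (Ici 0))
    (he : ∀ t ≥ 0, U t = 1 - Complex.I • ∫ s in (0 : ℝ)..t, H s * U s) {t : ℝ} (ht : 0 ≤ t) :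
    HasLipDeriv (fun s => star (U s)) (fun s => Complex.I • (star (U s) * H s)) 0 t :=
  (hH.hasLipDeriv hc he ht).star.congr_deriv fun x hx => by
    simp [star_smul, hH.star_eq x hx.1.le]

/-- An element commuting with the generator is invariant in the Heisenberg picture. -/
theorem IsGenerator.star_mul_mul (hH : IsGenerator H M) (hc : ContinuousOn U (Ici 0))
    (he : ∀ t ≥ 0, U t = 1 - Complex.I • ∫ s in (0 : ℝ)..t, H s * U s) {C : A}
    (hC : ∀ s ≥ 0, C * H s = H s * C) {t : ℝ} (ht : 0 ≤ t) : star (U t) * C * U t = C := by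
  have h := (((hH.hasLipDeriv_star hc he ht).mul (.const C)).mul (hH.hasLipDeriv hc he ht))
  have h' := (h.congr_deriv (g := fun _ => 0) fun x hx => ?_).eq_of_deriv_zero ht
  · simpa [evolution_zero he] using h'
  · simp only [mul_zero, add_zero, smul_mul_assoc, mul_neg, mul_smul_comm, mul_assoc]
    rw [← mul_assoc C, hC x hx.1.le, mul_assoc, add_neg_cancel]

variable [IsDedekindFiniteMonoid A]

theorem IsGenerator.mem_unitary (hH : IsGenerator H M) (hc : ContinuousOn U (Ici 0))
    (he : ∀ t ≥ 0, U t = 1 - Complex.I • ∫ s in (0 : ℝ)..t, H s * U s) {t : ℝ} (ht : 0 ≤ t) :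
    U t ∈ unitary A := by
  have h := hH.star_mul_mul hc he (C := 1) (by simp) ht
  rw [mul_one] at h
  -- Differentiation gives only `U† U = 1`; the other identity is Dedekind finiteness.
  exact Unitary.mem_iff.2 ⟨h, mul_eq_one_symm h⟩

theorem IsGenerator.commute (hH : IsGenerator H M) (hc : ContinuousOn U (Ici 0))
    (he : ∀ t ≥ 0, U t = 1 - Complex.I • ∫ s in (0 : ℝ)..t, H s * U s) {C : A}
    (hC : ∀ s ≥ 0, Commute C (H s)) {t : ℝ} (ht : 0 ≤ t) : Commute C (U t) := by
  have h := hH.star_mul_mul hc he hC ht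
  have hu := (Unitary.mem_iff.1 (hH.mem_unitary hc he ht)).2
  calc C * U t = U t * star (U t) * (C * U t) := by rw [hu, one_mul]
    _ = U t * (star (U t) * C * U t) := by noncomm_ring
    _ = U t * C := by rw [h]

/-- Duhamel's formula compares the commutators of a fixed element with the Heisenberg evolutions
generated by `H` and by `K`. -/
theorem norm_commutator_le_of_generators (hH : IsGenerator H M) (hK : IsGenerator K N)
    (hcU : ContinuousOn U (Ici 0))
    (heU : ∀ t ≥ 0, U t = 1 - Complex.I • ∫ s in (0 : ℝ)..t, H s * U s)
    (hcV : ContinuousOn V (Ici 0))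
    (heV : ∀ t ≥ 0, V t = 1 - Complex.I • ∫ s in (0 : ℝ)..t, K s * V s)
    {s t : ℝ} (hs : 0 ≤ s) (hst : s ≤ t) (a b : A)
    (hab : Commute a (V s * star (V t) * b * V t * star (V s))) {g : ℝ → ℝ}
    (hg : IntervalIntegrable g volume s t)
    (hbound : ∀ r ∈ Ioo s t, ‖⁅H r - K r, V r * star (V t) * b * V t * star (V r)⁆‖ ≤ g r) :
    ‖⁅a, U s * star (U t) * b * U t * star (U s)⁆‖ ≤ 2 * ‖a‖ * ∫ r in s..t, g r := by
  have ht := hs.trans hst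
  have uU : ∀ r, 0 ≤ r → U r ∈ unitary A := fun r hr => hH.mem_unitary hcU heU hr
  have uV : ∀ r, 0 ≤ r → V r ∈ unitary A := fun r hr => hK.mem_unitary hcV heV hr
  set c := star (V t) * b * V t with hc
  have dU := (hH.hasLipDeriv hcU heU ht).mono hs le_rfl
  have dUs := (hH.hasLipDeriv_star hcU heU ht).mono hs le_rfl
  have dV := (hK.hasLipDeriv hcV heV ht).mono hs le_rfl
  have dVs := (hK.hasLipDeriv_star hcV heV ht).mono hs le_rfl
  -- The interpolation `U_r† V_r c V_r† U_r` runs, after conjugation by `U s`, from the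
  -- `V`-evolution of `b` at `r = s` to its `U`-evolution at `r = t`. Its derivative contains only
  -- `H - K`.
  have dQ := (((dUs.mul dV).mul (.const c)).mul (dVs.mul dU)).congr_deriv
    (g := fun r => Complex.I • (star (U r) * ⁅H r - K r, V r * c * star (V r)⁆ * U r))
    fun r hr => by
      simp only [Ring.lie_def, mul_neg, mul_smul_comm, smul_mul_assoc, mul_zero, add_zero,
        ← smul_neg, ← smul_add, ← sub_eq_add_neg]
      congr 1
      noncomm_ring
  have dC := ((HasLipDeriv.const (a := s) (b := t) (U s)).mul dQ).mul (.const (star (U s)))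
  have dE := ((HasLipDeriv.const (a := s) (b := t) a).mul dC).sub (dC.mul (.const a))
  have main := dE.norm_sub_le hst (g := fun r => 2 * ‖a‖ * g r) (hg.const_mul _) fun r hr => by
    have hr0 : 0 ≤ r := hs.trans hr.1.le
    simp only [zero_mul, zero_add, mul_zero, add_zero]
    set q := ⁅H r - K r, V r * c * star (V r)⁆ with hq
    have hqn : ‖q‖ ≤ g r := by
      rw [hq, hc]
      simpa only [mul_assoc] using hbound r hr
    have hx : ‖U s * Complex.I • (star (U r) * q * U r) * star (U s)‖ = ‖q‖ := by
      rw [norm_mul_mul_star_of_mem_unitary (uU s hs), norm_smul, Complex.norm_I, one_mul]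
      simpa using norm_mul_mul_star_of_mem_unitary (Unitary.star_mem (uU r hr0)) q
    refine (norm_sub_le _ _).trans ((add_le_add (norm_mul_le _ _) (norm_mul_le _ _)).trans ?_)
    rw [hx]
    nlinarith [mul_le_mul_of_nonneg_left hqn (norm_nonneg a)]
  rw [intervalIntegral.integral_const_mul] at main
  have e1 : U s * (star (U t) * V t * c * (star (V t) * U t)) * star (U s)
      = U s * star (U t) * b * U t * star (U s) := by
    have := (Unitary.mem_iff.1 (uV t ht)).2
    calc _ = U s * star (U t) * (V t * star (V t)) * b * (V t * star (V t)) * U t * star (U s) := by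
          rw [hc]; noncomm_ring
      _ = _ := by rw [this]; noncomm_ring
  have e2 : U s * (star (U s) * V s * c * (star (V s) * U s)) * star (U s)
      = V s * star (V t) * b * V t * star (V s) := by
    have := (Unitary.mem_iff.1 (uU s hs)).2
    calc _ = (U s * star (U s)) * V s * c * star (V s) * (U s * star (U s)) := by noncomm_ring
      _ = _ := by rw [this, hc]; noncomm_ring
  simp only [e1, e2] at main
  rwa [hab.eq, sub_self, sub_zero, ← Ring.lie_def] at main

end Evolution

/-! ### Operators supported on regions -/

section Locality

variable {V : Type*} [Fintype V] [DecidableEq V]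
  {κ : V → Type*} [∀ v, DecidableEq (κ v)]

theorem ActsOn.mono {X X' : Finset V} (hX : X ⊆ X') {M : Op κ} (hM : ActsOn X M) :
    ActsOn X' M := by
  obtain ⟨A, rfl⟩ := hM
  refine ⟨fun a b => if ∀ v : X', v.1 ∉ X → a v = b v then
    A (fun v => a ⟨v, hX v.2⟩) (fun v => b ⟨v, hX v.2⟩) else 0, ?_⟩
  ext σ τ
  simp only [embed]
  by_cases h : ∀ v, v ∉ X → σ v = τ v
  · rw [if_pos h, if_pos fun v hv => h v fun hv' => hv (hX hv')]
    exact (if_pos (fun v : X' => h v.1)).symm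
  · rw [if_neg h]
    split_ifs with h1 h2
    · exact absurd (fun v hv => if hv' : v ∈ X' then h2 ⟨v, hv'⟩ hv else h1 v hv') h
    · rfl
    · rfl

variable [∀ v, Fintype (κ v)]

/-- The product of two operators acting on disjoint regions. -/
theorem embed_mul_embed_apply {X Y : Finset V} (hXY : Disjoint X Y)
    (A : Matrix (Config κ X) (Config κ X) ℂ) (B : Matrix (Config κ Y) (Config κ Y) ℂ)
    (σ τ : ∀ v, κ v) :
    (embed X A * embed Y B) σ τ = if ∀ v, v ∉ X → v ∉ Y → σ v = τ v then
      A (fun v => σ v) (fun v => τ v) * B (fun v => σ v) (fun v => τ v) else 0 := by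
  have hY : ∀ {v}, v ∈ Y → v ∉ X := fun hv hv' => Finset.disjoint_left.1 hXY hv' hv
  -- `A` changes the configuration on `X` only and `B` on `Y` only, so one intermediate
  -- configuration can contribute.
  rw [Matrix.mul_apply, Finset.sum_eq_single (fun v => if v ∈ X then τ v else σ v)]
  · have h1 : ∀ v, v ∉ X → σ v = if v ∈ X then τ v else σ v := fun v hv => by simp [hv]
    have h2 : (fun v : X => if v.1 ∈ X then τ v else σ v) = fun v : X => τ v := by
      ext v; simp
    have h3 : (fun v : Y => if v.1 ∈ X then τ v else σ v) = fun v : Y => σ v := by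
      ext v; simp [hY v.2]
    simp only [embed, if_pos h1, h2, h3]
    by_cases h : ∀ v, v ∉ X → v ∉ Y → σ v = τ v
    · rw [if_pos h, if_pos]
      intro v hv
      split_ifs with hx
      · rfl
      · exact h v hx hv
    · rw [if_neg h, if_neg, mul_zero]
      contrapose! h
      intro v hx hy
      simpa [hx] using h v hy
  · intro ρ _ hρ
    by_contra hne
    obtain ⟨h1, h2⟩ := mul_ne_zero_iff.1 hne
    simp only [embed, ne_eq, ite_eq_right_iff, Classical.not_imp] at h1 h2
    refine hρ (funext fun v => ?_)
    split_ifs with hx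
    · exact h2.1 v (Finset.disjoint_left.1 hXY hx)
    · exact (h1.1 v hx).symm
  · simp

theorem ActsOn.commute {X Y : Finset V} (hXY : Disjoint X Y) {M N : Op κ} (hM : ActsOn X M)
    (hN : ActsOn Y N) : Commute M N := by
  obtain ⟨A, rfl⟩ := hM
  obtain ⟨B, rfl⟩ := hN
  ext σ τ
  rw [embed_mul_embed_apply hXY, embed_mul_embed_apply hXY.symm, mul_comm]
  simp only [imp.swap]

theorem stronglyMeasurable_op {H : ℝ → Op κ} (h : ∀ σ τ, Measurable fun t => H t σ τ) :
    StronglyMeasurable H := by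
  have : H = fun t => ∑ σ, ∑ τ, H t σ τ • Matrix.single σ τ (1 : ℂ) := by
    ext1 t
    conv_lhs => rw [Matrix.matrix_eq_sum_single (H t)]
    simp [Matrix.smul_single]
  rw [this]
  refine Finset.stronglyMeasurable_fun_sum _ fun σ _ =>
    Finset.stronglyMeasurable_fun_sum _ fun τ _ => ?_
  exact (h σ τ).stronglyMeasurable.smul_const _

end Locality

/-! ### Truncated Hamiltonians and the recursive commutator estimate -/

section Hamiltonian

variable {V : Type*} [Fintype V] [DecidableEq V] {G : SimpleGraph V} [DecidableRel G.Adj]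
  {κ : V → Type*} [∀ v, Fintype (κ v)] [∀ v, DecidableEq (κ v)] {B J : ℝ}

/-- The part of the Hamiltonian consisting of the terms which do not touch the region `S`. -/
noncomputable def LocalHamiltonian.outside (h : LocalHamiltonian G κ B J) (S : Finset V) (t : ℝ) :
    Op κ :=
  ∑ v with v ∉ S, h.Φ₁ v t + ∑ e ∈ G.edgeFinset with Disjoint e.toFinset S, h.Φ₂ e t

variable (h : LocalHamiltonian G κ B J)

theorem LocalHamiltonian.outside_empty : h.outside ∅ = h.H := by
  ext1 t
  simp [outside, H]

theorem LocalHamiltonian.isGenerator_outside (S : Finset V) :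
    ∃ M, IsGenerator (h.outside S) M := by
  refine ⟨∑ v with v ∉ S, B + ∑ e ∈ G.edgeFinset with Disjoint e.toFinset S, J, ?_, ?_, ?_⟩
  · refine StronglyMeasurable.add ?_ ?_
    · exact Finset.stronglyMeasurable_fun_sum _ fun v _ => stronglyMeasurable_op (h.measurable₁ v)
    · exact Finset.stronglyMeasurable_fun_sum _ fun e he =>
        stronglyMeasurable_op (h.measurable₂ e (Finset.mem_filter.1 he).1)
  · intro t ht
    refine (norm_add_le _ _).trans (add_le_add ?_ ?_)
    · exact norm_sum_le_of_le _ fun v _ => h.norm_le₁ v t ht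
    · exact norm_sum_le_of_le _ fun e he => h.norm_le₂ e (Finset.mem_filter.1 he).1 t ht
  · intro t ht
    simp only [outside, star_add, star_sum]
    congr 1
    · exact Finset.sum_congr rfl fun v _ => h.hermitian₁ v t ht
    · exact Finset.sum_congr rfl fun e he => h.hermitian₂ e (Finset.mem_filter.1 he).1 t ht

theorem LocalHamiltonian.exists_isEvolution_outside (S : Finset V) :
    ∃ U, IsEvolution (h.outside S) U :=
  exists_evolution (h.isGenerator_outside S).choose_spec

variable {h}

theorem LocalHamiltonian.commute_outside {S : Finset V} {M : Op κ} (hM : ActsOn S M) {t : ℝ}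
    (ht : 0 ≤ t) : Commute M (h.outside S t) := by
  refine Commute.add_right (Commute.sum_right _ _ _ fun v hv => ?_)
    (Commute.sum_right _ _ _ fun e he => ?_)
  · exact hM.commute (by simpa using hv) (h.actsOn₁ v t ht)
  · have he := Finset.mem_filter.1 he
    exact hM.commute he.2.symm (h.actsOn₂ e he.1 t ht)

variable {S S' Y : Finset V} {U W : ℝ → Op κ} {s t : ℝ}

theorem IsEvolution.mem_unitary (hU : IsEvolution (h.outside S) U) (ht : 0 ≤ t) :
    U t ∈ unitary (Op κ) :=
  (h.isGenerator_outside S).choose_spec.mem_unitary hU.1 hU.2 ht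

theorem IsEvolution.commute (hU : IsEvolution (h.outside S) U) {M : Op κ} (hM : ActsOn S M)
    (ht : 0 ≤ t) : Commute M (U t) :=
  (h.isGenerator_outside S).choose_spec.commute hU.1 hU.2
    (fun _ hs => LocalHamiltonian.commute_outside hM hs) ht

theorem IsEvolution.commute_star (hU : IsEvolution (h.outside S) U) {M : Op κ} (hM : ActsOn S M)
    (ht : 0 ≤ t) : Commute M (star (U t)) := by
  have h1 := (h.isGenerator_outside S).choose_spec.star_mul_mul hU.1 hU.2
    (fun _ hs => LocalHamiltonian.commute_outside hM hs) ht
  have h2 := (Unitary.mem_iff.1 (hU.mem_unitary ht)).2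
  calc M * star (U t) = star (U t) * M * (U t * star (U t)) := by rw [← mul_assoc, h1]
    _ = star (U t) * M := by rw [h2, mul_one]

/-- The Heisenberg evolution of `b` from time `s` to time `t`. -/
noncomputable def heisenberg (U : ℝ → Op κ) (s t : ℝ) (b : Op κ) : Op κ :=
  U s * star (U t) * b * U t * star (U s)

theorem IsEvolution.commute_heisenberg (hU : IsEvolution (h.outside S) U) (hSY : Disjoint S Y)
    {a b : Op κ} (ha : ActsOn S a) (hb : ActsOn Y b) (hs : 0 ≤ s) (ht : 0 ≤ t) :
    Commute a (heisenberg U s t b) :=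
  ((((hU.commute ha hs).mul_right (hU.commute_star ha ht)).mul_right
    (ha.commute hSY hb)).mul_right (hU.commute ha ht)).mul_right (hU.commute_star ha hs)

theorem IsEvolution.norm_heisenberg (hU : IsEvolution (h.outside S) U) (hs : 0 ≤ s) (ht : 0 ≤ t)
    (b : Op κ) : ‖heisenberg U s t b‖ = ‖b‖ := by
  have h1 : heisenberg U s t b = U s * (star (U t) * b * star (star (U t))) * star (U s) := by
    simp only [heisenberg, star_star, mul_assoc]
  rw [h1, norm_mul_mul_star_of_mem_unitary (hU.mem_unitary hs),
    norm_mul_mul_star_of_mem_unitary (Unitary.star_mem (hU.mem_unitary ht))]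

/-- Only the bonds leaving `S'` contribute to the commutator of an operator that commutes with all
operators on `S'` with the terms that touch `S'` but not `S`. -/
theorem LocalHamiltonian.norm_commutator_outside_sub_le (hSS' : S ⊆ S') {c : Op κ}
    (hc : ∀ O : Op κ, ActsOn S' O → Commute O c) {g : V → ℝ} (hg0 : ∀ z, 0 ≤ g z)
    (hg : ∀ z ∉ S', ∀ O : Op κ, ActsOn (insert z S') O → ‖⁅O, c⁆‖ ≤ g z * ‖O‖) (ht : 0 ≤ t) :
    ‖⁅h.outside S t - h.outside S' t, c⁆‖ ≤
      ∑ x ∈ S' \ S, ∑ z with G.Adj x z ∧ z ∉ S', J * g z := by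
  have hlie : ∀ O : Op κ, Commute O c → ⁅O, c⁆ = 0 := fun O hO => commute_iff_lie_eq.1 hO
  have e1 : ∑ v with v ∉ S, h.Φ₁ v t =
      ∑ v ∈ S' \ S, h.Φ₁ v t + ∑ v with v ∉ S', h.Φ₁ v t := by
    rw [← Finset.sum_union]
    · refine Finset.sum_congr ?_ fun _ _ => rfl
      ext v
      have := @hSS' v
      simp; tauto
    · rw [Finset.disjoint_left]
      simp; tauto
  have e2 : ∑ e ∈ G.edgeFinset with Disjoint e.toFinset S, h.Φ₂ e t =
      ∑ e ∈ G.edgeFinset with Disjoint e.toFinset S ∧ ¬ Disjoint e.toFinset S', h.Φ₂ e t +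
      ∑ e ∈ G.edgeFinset with Disjoint e.toFinset S', h.Φ₂ e t := by
    rw [← Finset.sum_union]
    · refine Finset.sum_congr ?_ fun _ _ => rfl
      ext e
      have : Disjoint e.toFinset S' → Disjoint e.toFinset S := fun hd => hd.mono_right hSS'
      simp only [Finset.mem_filter, Finset.mem_union]; tauto
    · rw [Finset.disjoint_left]
      simp only [Finset.mem_filter]; tauto
  have e3 : h.outside S t - h.outside S' t = ∑ v ∈ S' \ S, h.Φ₁ v t +
      ∑ e ∈ G.edgeFinset with Disjoint e.toFinset S ∧ ¬ Disjoint e.toFinset S', h.Φ₂ e t := by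
    simp only [outside]
    rw [e1, e2]; abel
  -- The on-site terms in the difference all lie inside `S'`; this is where `B` disappears.
  have e4 : ∑ v ∈ S' \ S, ⁅h.Φ₁ v t, c⁆ = 0 := Finset.sum_eq_zero fun v hv => by
    refine hlie _ (hc _ ((h.actsOn₁ v t ht).mono ?_))
    simpa using (Finset.mem_sdiff.1 hv).1
  have e5 : ⁅h.outside S t - h.outside S' t, c⁆ =
      ∑ e ∈ G.edgeFinset with Disjoint e.toFinset S ∧ ¬ Disjoint e.toFinset S', ⁅h.Φ₂ e t, c⁆ := by
    rw [← zero_add (∑ e ∈ G.edgeFinset with _, _), ← e4, e3]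
    simp only [Ring.lie_def, add_mul, mul_add, Finset.sum_mul, Finset.mul_sum,
      Finset.sum_sub_distrib]
    abel
  rw [e5, Finset.sum_sigma']
  -- The surviving bonds have exactly one end in `S'`. Orienting them outwards makes the passage
  -- from bonds to ordered pairs injective.
  set D := (S' \ S).sigma fun x => {z | G.Adj x z ∧ z ∉ S'} with hD
  have hmem : ∀ p : Σ _ : V, V, p ∈ D ↔ (p.1 ∈ S' ∧ p.1 ∉ S) ∧ G.Adj p.1 p.2 ∧ p.2 ∉ S' := by
    simp [hD]
  have hinj : Set.InjOn (fun p : Σ _ : V, V => s(p.1, p.2)) D := by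
    rintro ⟨x, z⟩ hp ⟨x', z'⟩ hp' he
    have hp := (hmem _).1 hp
    have hp' := (hmem _).1 hp'
    rcases Sym2.eq_iff.1 he with ⟨h1, h2⟩ | ⟨h1, h2⟩
    · simp only at h1 h2
      rw [h1, h2]
    · exact absurd (h1 ▸ hp.1.1) hp'.2.2
  calc _ ≤ ∑ e ∈ G.edgeFinset with Disjoint e.toFinset S ∧ ¬ Disjoint e.toFinset S',
          ‖⁅h.Φ₂ e t, c⁆‖ := norm_sum_le _ _
    _ ≤ ∑ e ∈ D.image (fun p => s(p.1, p.2)), ‖⁅h.Φ₂ e t, c⁆‖ := by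
      rw [← Finset.sum_filter_ne_zero]
      refine Finset.sum_le_sum_of_subset_of_nonneg (fun e he => ?_) fun _ _ _ => norm_nonneg _
      obtain ⟨he, hne⟩ := Finset.mem_filter.1 he
      obtain ⟨heG, heS, heS'⟩ := Finset.mem_filter.1 he
      have hsub : ¬ e.toFinset ⊆ S' := fun hsub => hne (by
        rw [hlie _ (hc _ ((h.actsOn₂ e heG t ht).mono hsub)), norm_zero])
      obtain ⟨x, hx, hxS'⟩ := Finset.not_disjoint_iff.1 heS'
      obtain ⟨z, hz, hzS'⟩ := Finset.not_subset.1 hsub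
      have hxz : x ≠ z := fun hxz => hzS' (hxz ▸ hxS')
      have hexz : e = s(x, z) :=
        (Sym2.mem_and_mem_iff hxz).1 ⟨Sym2.mem_toFinset.1 hx, Sym2.mem_toFinset.1 hz⟩
      refine Finset.mem_image.2 ⟨⟨x, z⟩,
        (hmem _).2 ⟨⟨hxS', Finset.disjoint_left.1 heS hx⟩, ?_, hzS'⟩, hexz.symm⟩
      rwa [hexz, SimpleGraph.mem_edgeFinset, SimpleGraph.mem_edgeSet] at heG
    _ = ∑ p ∈ D, ‖⁅h.Φ₂ s(p.1, p.2) t, c⁆‖ := Finset.sum_image hinj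
    _ ≤ _ := by
      refine Finset.sum_le_sum fun p hp => ?_
      obtain ⟨⟨hx, -⟩, hadj, hz⟩ := (hmem p).1 hp
      have heG : s(p.1, p.2) ∈ G.edgeFinset := by simpa using hadj
      refine (hg p.2 hz _ ((h.actsOn₂ _ heG t ht).mono fun v hv => ?_)).trans ?_
      · rcases Sym2.mem_iff.1 (Sym2.mem_toFinset.1 hv) with rfl | rfl
        · exact Finset.mem_insert_of_mem hx
        · exact Finset.mem_insert_self _ _
      · rw [mul_comm]
        exact mul_le_mul_of_nonneg_right (h.norm_le₂ _ heG t ht) (hg0 _)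

/-- The recursive step: the commutator for the dynamics outside `S` of an operator acting on
`S' ⊇ S` is controlled by the commutators for the dynamics outside `S'` of the operators acting on
`S'` and one adjacent vertex. -/
theorem IsEvolution.norm_commutator_le (hSS' : S ⊆ S') (hSY : Disjoint S' Y)
    (hU : IsEvolution (h.outside S) U) (hW : IsEvolution (h.outside S') W) (hs : 0 ≤ s)
    (hst : s ≤ t) {a b : Op κ} (ha : ActsOn S' a) (hb : ActsOn Y b) {g : V → ℝ → ℝ}
    (hgc : ∀ z, Continuous (g z)) (hg0 : ∀ z, ∀ r ∈ Icc s t, 0 ≤ g z r)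
    (hg : ∀ r ∈ Icc s t, ∀ z ∉ S', ∀ O : Op κ, ActsOn (insert z S') O →
      ‖⁅O, heisenberg W r t b⁆‖ ≤ g z r * ‖O‖) :
    ‖⁅a, heisenberg U s t b⁆‖ ≤ 2 * ‖a‖ *
      ∑ x ∈ S' \ S, ∑ z with G.Adj x z ∧ z ∉ S', J * ∫ r in s..t, g z r := by
  have ht := hs.trans hst
  have hgi : ∀ z, IntervalIntegrable (fun r => J * g z r) volume s t := fun z =>
    (continuous_const.mul (hgc z)).intervalIntegrable _ _
  have main := norm_commutator_le_of_generators (h.isGenerator_outside S).choose_spec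
    (h.isGenerator_outside S').choose_spec hU.1 hU.2 hW.1 hW.2 hs hst a b
    (hW.commute_heisenberg hSY ha hb hs ht)
    (g := fun r => ∑ x ∈ S' \ S, ∑ z with G.Adj x z ∧ z ∉ S', J * g z r)
    ((continuous_finsetSum _ fun x _ => continuous_finsetSum _ fun z _ =>
      continuous_const.mul (hgc z)).intervalIntegrable _ _)
    fun r hr => LocalHamiltonian.norm_commutator_outside_sub_le hSS'
      (fun O hO => hW.commute_heisenberg hSY hO hb (hs.trans hr.1.le) ht)
      (fun z => hg0 z r (Ioo_subset_Icc_self hr))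
      (fun z hz O hO => hg r (Ioo_subset_Icc_self hr) z hz O hO)
      (hs.trans hr.1.le)
  refine main.trans_eq ?_
  rw [intervalIntegral.integral_finsetSum fun x _ =>
    by simpa only [Finset.sum_fn] using IntervalIntegrable.sum _ fun z _ => hgi z]
  congr 1
  refine Finset.sum_congr rfl fun x _ => ?_
  rw [intervalIntegral.integral_finsetSum fun z _ => hgi z]
  refine Finset.sum_congr rfl fun z _ => ?_
  rw [intervalIntegral.integral_const_mul]

end Hamiltonian

/-! ### Counting walks -/

section Counting

variable {V : Type*} [Fintype V] [DecidableEq V] (G : SimpleGraph V) [DecidableRel G.Adj]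

/-- The number of self-avoiding walks of length `n` that start in `y`, avoid `S`, and end at their
first visit of `Y`. -/
def avoidCount (Y : Finset V) : ℕ → Finset V → V → ℕ
  | 0, _, y => if y ∈ Y then 1 else 0
  | n + 1, S, y => if y ∈ Y then 0 else
      ∑ z with G.Adj y z ∧ z ∉ insert y S, avoidCount Y n (insert y S) z

/-- The number of ways to leave `X` by an edge and then to continue to `Y` by a self-avoiding walk
of length `n` outside `X`. -/
def escapeCount (X Y : Finset V) (n : ℕ) : ℕ :=
  ∑ x ∈ X, ∑ z with G.Adj x z ∧ z ∉ X, avoidCount G Y n X z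

/-- The number of walks of length `n` from `x` to `y`. -/
def walkCount (n : ℕ) (x y : V) : ℕ := (G.adjMatrix ℕ ^ n) x y

theorem walkCount_zero (x y : V) : walkCount G 0 x y = if x = y then 1 else 0 := by
  simp [walkCount, Matrix.one_apply]

theorem walkCount_comm (n : ℕ) (x y : V) : walkCount G n x y = walkCount G n y x := by
  have h : ((G.adjMatrix ℕ ^ n)ᵀ : Matrix V V ℕ) = G.adjMatrix ℕ ^ n := by
    rw [Matrix.transpose_pow, SimpleGraph.transpose_adjMatrix]
  exact congrFun (congrFun h y) x

theorem sum_walkCount_succ (Y : Finset V) (n : ℕ) (x : V) :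
    ∑ y ∈ Y, walkCount G (n + 1) x y = ∑ z with G.Adj x z, ∑ y ∈ Y, walkCount G n z y := by
  rw [Finset.sum_comm]
  refine Finset.sum_congr rfl fun y _ => ?_
  rw [walkCount, pow_succ', Matrix.mul_apply, Finset.sum_filter]
  refine Finset.sum_congr rfl fun z _ => ?_
  rw [SimpleGraph.adjMatrix_apply, ite_mul, one_mul, zero_mul, walkCount]

theorem avoidCount_le (Y : Finset V) (n : ℕ) (S : Finset V) (y : V) :
    avoidCount G Y n S y ≤ ∑ y' ∈ Y, walkCount G n y y' := by
  induction n generalizing S y with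
  | zero => simp [avoidCount, walkCount_zero]
  | succ n ih =>
    rw [sum_walkCount_succ, avoidCount]
    split_ifs
    · exact Nat.zero_le _
    · refine (Finset.sum_le_sum fun z _ => ih _ z).trans (Finset.sum_le_sum_of_subset ?_)
      exact Finset.monotone_filter_right _ fun z _ hz => hz.1

theorem pathCount_eq (X Y : Finset V) (n : ℕ) :
    pathCount G X Y n = ∑ x ∈ X, ∑ y ∈ Y, walkCount G n x y := by
  refine Finset.sum_congr rfl fun x _ => Finset.sum_congr rfl fun y _ => ?_
  rw [walkCount, SimpleGraph.adjMatrix_pow_apply_eq_card_walk, Nat.cast_id,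
    Set.ncard_eq_toFinset_card', Set.toFinset_card]

/-- The exit edge is the first step of the walk, which accounts for the length `n + 1`. -/
theorem escapeCount_le (X Y : Finset V) (n : ℕ) :
    escapeCount G X Y n ≤ pathCount G X Y (n + 1) := by
  rw [pathCount_eq]
  refine Finset.sum_le_sum fun x _ => ?_
  rw [sum_walkCount_succ]
  refine (Finset.sum_le_sum fun z _ => avoidCount_le G Y n X z).trans
    (Finset.sum_le_sum_of_subset ?_)
  exact Finset.monotone_filter_right _ fun z _ hz => hz.1

theorem pathCount_comm (X Y : Finset V) (n : ℕ) : pathCount G X Y n = pathCount G Y X n := by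
  rw [pathCount_eq, pathCount_eq, Finset.sum_comm]
  exact Finset.sum_congr rfl fun x _ => Finset.sum_congr rfl fun y _ => walkCount_comm G n y x

/-- Summing over the end points together keeps `|Y|` out of the bound: each step has at most
`maxDegree` choices. -/
theorem sum_walkCount_le (Y : Finset V) (n : ℕ) (x : V) :
    ∑ y ∈ Y, walkCount G n x y ≤ G.maxDegree ^ n := by
  induction n generalizing x with
  | zero =>
    simp only [walkCount_zero, Finset.sum_ite_eq]
    split_ifs <;> simp
  | succ n ih =>
    rw [sum_walkCount_succ, pow_succ']
    refine (Finset.sum_le_card_nsmul _ _ _ fun z _ => ih z).trans ?_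
    rw [smul_eq_mul]
    refine Nat.mul_le_mul_right _ ((le_of_eq ?_).trans (G.degree_le_maxDegree x))
    rw [← SimpleGraph.card_neighborFinset_eq_degree]
    congr 1
    ext z
    simp

theorem pathCount_le (X Y : Finset V) (n : ℕ) :
    pathCount G X Y n ≤ X.card * G.maxDegree ^ n := by
  rw [pathCount_eq]
  exact Finset.sum_le_card_nsmul _ _ _ fun x _ => sum_walkCount_le G Y n x

theorem pathCount_eq_zero {X Y : Finset V} {R n : ℕ} (hR : (R : ℕ∞) ≤ regionDist G X Y)
    (hn : n < R) : pathCount G X Y n = 0 := by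
  refine Finset.sum_eq_zero fun x hx => Finset.sum_eq_zero fun y hy => ?_
  rw [Set.ncard_eq_zero (Set.toFinite _)]
  refine Set.eq_empty_of_forall_notMem fun p (hp : p.length = n) => ?_
  have h1 : (R : ℕ∞) ≤ p.length :=
    hR.trans ((iInf₂_le x hx).trans ((iInf₂_le y hy).trans (SimpleGraph.edist_le p)))
  rw [hp, Nat.cast_le] at h1
  omega

theorem sum_le_of_subsingleton {ι : Type*} {s : Finset ι} {f : ι → ℕ} {c : ℕ}
    (hs : ∀ i ∈ s, ∀ j ∈ s, i = j) (hf : ∀ i ∈ s, f i ≤ c) : ∑ i ∈ s, f i ≤ c := by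
  rcases s.eq_empty_or_nonempty with rfl | ⟨i, hi⟩
  · simp
  · rw [Finset.sum_eq_single_of_mem i hi fun j hj hji => absurd (hs j hj i hi) hji]
    exact hf i hi

variable {G} {g : V → ℤ} {Y : Finset V} {y₀ : V}

/-- On a line, the only self-avoiding walk to the right is the direct one. -/
theorem avoidCount_line_le (hg : Function.Injective g)
    (hadj : ∀ x z, G.Adj x z → g z = g x + 1 ∨ g x = g z + 1) (hy₀ : y₀ ∈ Y)
    (hY : ∀ y ∈ Y, g y₀ ≤ g y) (n : ℕ) (y : V) (hy : g y ≤ g y₀) :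
    avoidCount G Y n {v | g v < g y} y ≤ if g y + n = g y₀ then 1 else 0 := by
  induction n generalizing y with
  | zero =>
    simp only [avoidCount]
    split_ifs with h1 h2 <;> first | omega | skip
    have := hY y h1
    simp at h2; omega
  | succ n ih =>
    simp only [avoidCount]
    split_ifs with h1 h2 h2
    · simp
    · simp
    all_goals
      have hlt : g y < g y₀ := lt_of_le_of_ne hy fun he => h1 (hg he ▸ hy₀)
      have hz : ∀ z, G.Adj y z ∧ z ∉ insert y ({v | g v < g y} : Finset V) → g z = g y + 1 := by
        rintro z ⟨ha, hz⟩
        have := hadj y z ha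
        simp at hz
        omega
      refine sum_le_of_subsingleton (fun i hi j hj => hg ?_) fun z hz' => ?_
      · rw [hz i (by simpa using hi), hz j (by simpa using hj)]
      · have hgz := hz z (by simpa using hz')
        have hS : insert y ({v | g v < g y} : Finset V) = ({v | g v < g z} : Finset V) := by
          ext v
          have : v = y ↔ g v = g y := hg.eq_iff.symm
          simp [this, hgz]; omega
        rw [hS]
        refine (ih z (by omega)).trans ?_
        split_ifs <;> push_cast at * <;> omega

/-- A half-line has a single possible exit, from its last vertex `x₀` to the right neighbour; from
there the walk is forced. -/
theorem escapeCount_line_le (hg : Function.Injective g)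
    (hadj : ∀ x z, G.Adj x z → g z = g x + 1 ∨ g x = g z + 1) (hy₀ : y₀ ∈ Y)
    (hY : ∀ y ∈ Y, g y₀ ≤ g y) {x₀ : V} (hx₀ : g x₀ < g y₀) (n : ℕ) :
    escapeCount G {v | g v ≤ g x₀} Y n ≤ if g x₀ + (n + 1) = g y₀ then 1 else 0 := by
  have hz : ∀ x z, g x ≤ g x₀ → G.Adj x z → ¬ g z ≤ g x₀ → x = x₀ ∧ g z = g x₀ + 1 := by
    intro x z hx ha hz
    have := hadj x z ha
    exact ⟨hg (by omega), by omega⟩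
  rw [escapeCount, Finset.sum_eq_single x₀]
  · refine sum_le_of_subsingleton (fun i hi j hj => hg ?_) fun z hz' => ?_
    · simp only [Finset.mem_filter, Finset.mem_univ, true_and] at hi hj
      rw [(hz x₀ i le_rfl hi.1 hi.2).2, (hz x₀ j le_rfl hj.1 hj.2).2]
    · simp only [Finset.mem_filter, Finset.mem_univ, true_and] at hz'
      have hgz := (hz x₀ z le_rfl hz'.1 hz'.2).2
      have hS : ({v | g v ≤ g x₀} : Finset V) = ({v | g v < g z} : Finset V) := by
        ext v
        simp [hgz]
      rw [hS]
      refine (avoidCount_line_le hg hadj hy₀ hY n z (by omega)).trans ?_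
      split_ifs <;> omega
  · intro x hx hne
    refine Finset.sum_eq_zero fun z hz' => ?_
    simp only [Finset.mem_filter, Finset.mem_univ, true_and] at hz' hx
    exact absurd (hz x z hx hz'.1 hz'.2).1 hne
  · simp

end Counting

/-! ### The Lieb–Robinson bound by self-avoiding walks -/

section LiebRobinson

variable {V : Type*} [Fintype V] [DecidableEq V] {G : SimpleGraph V} [DecidableRel G.Adj]
  {κ : V → Type*} [∀ v, Fintype (κ v)] [∀ v, DecidableEq (κ v)] {B J : ℝ}
  {h : LocalHamiltonian G κ B J} {X Y : Finset V} {s t : ℝ}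

/-- The effect of one recursion step: `2` from Duhamel's estimate and `J` from the bond raise the
order of the term by one. -/
theorem integral_pow_sub_div_factorial (J s t : ℝ) (n : ℕ) :
    2 * (J * ∫ r in s..t, (2 * J * (t - r)) ^ n / n !) =
      (2 * J * (t - s)) ^ (n + 1) / (n + 1)! := by
  rw [intervalIntegral.integral_comp_sub_left (fun r => (2 * J * r) ^ n / n !) t]
  simp only [sub_self, mul_pow, mul_div_right_comm]
  rw [intervalIntegral.integral_const_mul, integral_pow, Nat.factorial_succ]
  push_cast
  have : (n ! : ℝ) ≠ 0 := by positivity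
  field_simp
  ring

/-- The bound on commutators by a truncated series whose coefficients are `w`. -/
noncomputable def countSum (J : ℝ) (m : ℕ) (w : ℕ → ℕ) (τ : ℝ) : ℝ :=
  ∑ n ∈ Finset.range m, (2 * J * τ) ^ n / n ! * w n

theorem countSum_nonneg (hJ : 0 ≤ J) (m : ℕ) (w : ℕ → ℕ) {τ : ℝ} (hτ : 0 ≤ τ) :
    0 ≤ countSum J m w τ := Finset.sum_nonneg fun n _ => by positivity

theorem continuous_countSum (J : ℝ) (m : ℕ) (w : ℕ → ℕ) : Continuous (countSum J m w) := by
  unfold countSum; fun_prop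

theorem integral_countSum (J : ℝ) (m : ℕ) (w : ℕ → ℕ) (s t : ℝ) :
    2 * (J * ∫ r in s..t, countSum J m w (t - r)) =
      ∑ n ∈ Finset.range m, (2 * J * (t - s)) ^ (n + 1) / (n + 1)! * w n := by
  simp only [countSum]
  rw [intervalIntegral.integral_finsetSum fun n _ =>
    Continuous.intervalIntegrable (by fun_prop) _ _, Finset.mul_sum, Finset.mul_sum]
  refine Finset.sum_congr rfl fun n _ => ?_
  rw [intervalIntegral.integral_mul_const, ← integral_pow_sub_div_factorial]
  ring

theorem norm_lie_le {A : Type*} [NormedRing A] (a b : A) : ‖⁅a, b⁆‖ ≤ 2 * ‖b‖ * ‖a‖ := by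
  rw [Ring.lie_def]
  refine (norm_sub_le _ _).trans ?_
  linarith [norm_mul_le a b, norm_mul_le b a]

theorem IsEvolution.norm_commutator_avoid_le (hJ : 0 ≤ J) {m : ℕ} {S : Finset V} {y : V}
    (hm : Sᶜ.card ≤ m) (hy : y ∉ S) (hSY : Disjoint S Y) {W : ℝ → Op κ}
    (hW : IsEvolution (h.outside S) W) (hs : 0 ≤ s) (hst : s ≤ t) {a b : Op κ}
    (ha : ActsOn (insert y S) a) (hb : ActsOn Y b) :
    ‖⁅a, heisenberg W s t b⁆‖ ≤
      2 * ‖b‖ * countSum J m (fun n => avoidCount G Y n S y) (t - s) * ‖a‖ := by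
  -- `m` bounds the number of vertices outside `S`, which drops at every step; with none left there
  -- is no `y ∉ S`.
  induction m generalizing S y W s a with
  | zero =>
    have : y ∈ Sᶜ := by simpa
    rw [Nat.le_zero, Finset.card_eq_zero] at hm
    simp [hm] at this
  | succ m ih =>
    by_cases hyY : y ∈ Y
    -- A walk that has reached `Y` stops: the trivial bound `2‖a‖‖b‖` is the term `n = 0`.
    · have h1 : 1 ≤ countSum J (m + 1) (fun n => avoidCount G Y n S y) (t - s) := by
        rw [countSum, Finset.sum_range_succ']
        simp only [avoidCount, hyY, if_true]
        simp
      have h2 := norm_lie_le a (heisenberg W s t b)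
      rw [hW.norm_heisenberg hs (hs.trans hst)] at h2
      refine h2.trans ?_
      have : 0 ≤ ‖b‖ * ‖a‖ := by positivity
      nlinarith
    · obtain ⟨W', hW'⟩ := h.exists_isEvolution_outside (insert y S)
      have hSY' : Disjoint (insert y S) Y := Finset.disjoint_insert_left.2 ⟨hyY, hSY⟩
      have hcard : (insert y S)ᶜ.card ≤ m := by
        have h1 := Finset.card_insert_of_notMem hy
        rw [Finset.card_compl] at hm ⊢
        omega
      have main := hW.norm_commutator_le (Finset.subset_insert y S) hSY' hW' hs hst ha hb
        (g := fun z r => 2 * ‖b‖ * countSum J m (fun n => avoidCount G Y n (insert y S) z) (t - r))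
        (fun z => continuous_const.mul ((continuous_countSum J m _).comp (by fun_prop)))
        (fun z r hr => mul_nonneg (by positivity) (countSum_nonneg hJ _ _ (by linarith [hr.2])))
        (fun r hr z hz O hO => ih hcard hz hSY' hW' (hs.trans hr.1) hr.2 hO)
      refine main.trans_eq ?_
      have hsd : insert y S \ S = {y} := by
        rw [Finset.insert_sdiff_of_notMem _ hy, Finset.sdiff_self]; rfl
      rw [hsd, Finset.sum_singleton]
      simp only [intervalIntegral.integral_const_mul]
      have e : ∀ z, J * (2 * ‖b‖ * ∫ r in s..t,
          countSum J m (fun n => avoidCount G Y n (insert y S) z) (t - r)) =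
          ‖b‖ * ∑ n ∈ Finset.range m, (2 * J * (t - s)) ^ (n + 1) / (n + 1)! *
            avoidCount G Y n (insert y S) z := fun z => by
        rw [← integral_countSum]; ring
      rw [Finset.sum_congr rfl fun z _ => e z, ← Finset.mul_sum, Finset.sum_comm, countSum,
        Finset.sum_range_succ']
      simp only [avoidCount, hyY, if_false, ← Finset.mul_sum, Nat.cast_zero, mul_zero, add_zero,
        Nat.cast_sum]
      ring

/-- The first step goes from `∅` to all of `X` at once, so every vertex of `X` may emit the first
bond; later steps add single vertices. -/
theorem IsEvolution.norm_commutator_escape_le (hJ : 0 ≤ J) (hXY : Disjoint X Y) {U : ℝ → Op κ}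
    (hU : IsEvolution h.H U) (ht : 0 ≤ t) {a b : Op κ} (ha : ActsOn X a) (hb : ActsOn Y b) :
    ‖⁅a, heisenberg U 0 t b⁆‖ ≤ 2 * (∑ n ∈ Finset.range (Fintype.card V),
      (2 * J * t) ^ (n + 1) / (n + 1)! * escapeCount G X Y n) * ‖a‖ * ‖b‖ := by
  obtain ⟨W, hW⟩ := h.exists_isEvolution_outside X
  rw [← h.outside_empty] at hU
  have main := hU.norm_commutator_le (Finset.empty_subset X) hXY hW le_rfl ht ha hb
    (g := fun z r => 2 * ‖b‖ * countSum J (Fintype.card V) (fun n => avoidCount G Y n X z) (t - r))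
    (fun z => continuous_const.mul ((continuous_countSum J _ _).comp (by fun_prop)))
    (fun z r hr => mul_nonneg (by positivity) (countSum_nonneg hJ _ _ (by linarith [hr.2])))
    (fun r hr z hz O hO => hW.norm_commutator_avoid_le hJ (Finset.card_le_univ _) hz hXY
      hr.1 hr.2 hO hb)
  refine main.trans_eq ?_
  simp only [intervalIntegral.integral_const_mul, Finset.sdiff_empty]
  have e : ∀ z, J * (2 * ‖b‖ * ∫ r in (0 : ℝ)..t,
      countSum J (Fintype.card V) (fun n => avoidCount G Y n X z) (t - r)) =
      ‖b‖ * ∑ n ∈ Finset.range (Fintype.card V), (2 * J * t) ^ (n + 1) / (n + 1)! *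
        avoidCount G Y n X z := fun z => by
    have := integral_countSum J (Fintype.card V) (fun n => avoidCount G Y n X z) 0 t
    rw [sub_zero] at this
    rw [← this]; ring
  have e' : ∀ x, ∑ z with G.Adj x z ∧ z ∉ X, J * (2 * ‖b‖ * ∫ r in (0 : ℝ)..t,
      countSum J (Fintype.card V) (fun n => avoidCount G Y n X z) (t - r)) =
      ‖b‖ * ∑ n ∈ Finset.range (Fintype.card V), (2 * J * t) ^ (n + 1) / (n + 1)! *
        ∑ z with G.Adj x z ∧ z ∉ X, (avoidCount G Y n X z : ℝ) := fun x => by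
    rw [Finset.sum_congr rfl fun z _ => e z, ← Finset.mul_sum, Finset.sum_comm]
    simp only [Finset.mul_sum]
  rw [Finset.sum_congr rfl fun x _ => e' x, ← Finset.mul_sum, Finset.sum_comm]
  simp only [← Finset.mul_sum, escapeCount, Nat.cast_sum]
  ring

theorem IsEvolution.isCommutatorBound_escape (hJ : 0 ≤ J) (hXY : Disjoint X Y) {U : ℝ → Op κ}
    (hU : IsEvolution h.H U) (ht : 0 ≤ t) :
    IsCommutatorBound (U t) X Y (2 * ∑ n ∈ Finset.range (Fintype.card V),
      (2 * J * t) ^ (n + 1) / (n + 1)! * escapeCount G X Y n) := by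
  intro a b ha hb
  have hU' : IsEvolution (h.outside ∅) U := h.outside_empty ▸ hU
  have hu := hU'.mem_unitary ht
  have h0 : U 0 = 1 := evolution_zero hU.2
  have e : ⁅U t * a * (U t)ᴴ, b⁆ = U t * ⁅a, heisenberg U 0 t b⁆ * star (U t) := by
    have h1 := (Unitary.mem_iff.1 hu).2
    rw [heisenberg, h0, star_one, mul_one, one_mul, Ring.lie_def, Ring.lie_def,
      ← Matrix.star_eq_conjTranspose]
    calc _ = U t * a * star (U t) * b * 1 - 1 * b * U t * a * star (U t) := by noncomm_ring
      _ = _ := by rw [← h1]; noncomm_ring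
  rw [e, norm_mul_mul_star_of_mem_unitary hu]
  exact hU.norm_commutator_escape_le hJ hXY ht ha hb

end LiebRobinson

end Analysis

/-! ### Trace inequalities and the fidelity -/

section Fidelity

open Matrix

variable {ι : Type*} [Fintype ι] [DecidableEq ι]

theorem exists_eq_unitary_mul_diagonal {A : Matrix ι ι ℂ} (hA : A.IsHermitian) :
    ∃ u : Matrix ι ι ℂ, star u * u = 1 ∧ u * star u = 1 ∧
      A = u * diagonal (fun i => (hA.eigenvalues i : ℂ)) * star u :=
  ⟨hA.eigenvectorUnitary, Unitary.coe_star_mul_self _, Unitary.coe_mul_star_self _, by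
    conv_lhs => rw [hA.spectral_theorem, Unitary.conjStarAlgAut_apply]
    rfl⟩

theorem trace_star_mul_mul {u : Matrix ι ι ℂ} (hu : u * star u = 1) (M : Matrix ι ι ℂ) :
    (star u * M * u).trace = M.trace := by
  rw [trace_mul_cycle, hu, one_mul]

theorem norm_apply_le_l2_opNorm (M : Matrix ι ι ℂ) (i j : ι) : ‖M i j‖ ≤ ‖M‖ := by
  have h1 := l2_opNorm_mulVec M (EuclideanSpace.single j 1)
  rw [PiLp.norm_single, norm_one, mul_one] at h1
  refine le_trans ?_ ((PiLp.norm_apply_le _ i).trans h1)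
  simp

theorem IsDensity.norm_trace_mul_le {ρ : Matrix ι ι ℂ} (hρ : IsDensity ρ) (M : Matrix ι ι ℂ) :
    ‖(ρ * M).trace‖ ≤ ‖M‖ := by
  obtain ⟨u, hu, hu', he⟩ := exists_eq_unitary_mul_diagonal hρ.1.isHermitian
  set p := hρ.1.isHermitian.eigenvalues
  have hp : ∀ i, 0 ≤ p i := hρ.1.eigenvalues_nonneg
  have hsum : ∑ i, p i = 1 := by
    have h1 := hρ.2
    rw [he, trace_mul_comm, ← mul_assoc, hu, one_mul, trace_diagonal] at h1
    exact_mod_cast h1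
  have hN : ‖star u * M * u‖ ≤ ‖M‖ := by
    have := norm_mul_mul_star_of_mem_unitary (Unitary.star_mem (Unitary.mem_iff.2 ⟨hu, hu'⟩)) M
    rw [star_star] at this
    exact this.le
  have e : (ρ * M).trace = ∑ i, p i * (star u * M * u) i i := by
    rw [he, ← trace_star_mul_mul hu']
    have : star u * (u * diagonal (fun i => (p i : ℂ)) * star u * M) * u =
        diagonal (fun i => (p i : ℂ)) * (star u * M * u) := by
      calc _ = (star u * u) * diagonal (fun i => (p i : ℂ)) * (star u * M * u) := by noncomm_ring
        _ = _ := by rw [hu, one_mul]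
    rw [this]
    simp [trace, diagonal_mul]
  rw [e]
  calc _ ≤ ∑ i, p i * ‖M‖ := by
        refine norm_sum_le_of_le _ fun i _ => ?_
        rw [norm_mul, Complex.norm_real, Real.norm_of_nonneg (hp i)]
        exact mul_le_mul_of_nonneg_left ((norm_apply_le_l2_opNorm _ i i).trans hN) (hp i)
    _ = ‖M‖ := by rw [← Finset.sum_mul, hsum, one_mul]

/-- The trace norm dominates the trace. -/
theorem re_trace_le_re_trace_sqrt (M : Matrix ι ι ℂ) :
    M.trace.re ≤ (CFC.sqrt (star M * M)).trace.re := by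
  set P := CFC.sqrt (star M * M) with hPdef
  have hP : P.PosSemidef := nonneg_iff_posSemidef.1 (CFC.sqrt_nonneg _)
  have hPP : P * P = star M * M := CFC.sqrt_mul_sqrt_self _ (star_mul_self_nonneg M)
  obtain ⟨u, hu, hu', he⟩ := exists_eq_unitary_mul_diagonal hP.isHermitian
  set p := hP.isHermitian.eigenvalues
  have hp : ∀ i, 0 ≤ p i := hP.eigenvalues_nonneg
  set N := star u * M * u with hN
  have hNN : star N * N = diagonal (fun i => (p i : ℂ) * p i) := by
    calc star N * N = star u * star M * (u * star u) * M * u := by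
          simp only [hN, star_mul, star_star]; noncomm_ring
      _ = star u * (P * P) * u := by rw [hu', hPP]; noncomm_ring
      _ = (star u * u) * diagonal (fun i => (p i : ℂ)) * (star u * u) *
            diagonal (fun i => (p i : ℂ)) * (star u * u) := by
          conv_lhs => rw [he]
          noncomm_ring
      _ = _ := by simp [hu]
  -- In the eigenbasis of `|M|`, column `i` of `N` has Euclidean norm `p i`, which dominates its
  -- diagonal entry.
  have hNi : ∀ i, (N i i).re ≤ p i := fun i => by
    have h1 : ∑ j, ‖N j i‖ ^ 2 = p i ^ 2 := by
      have h2 := congrFun (congrFun hNN i) i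
      rw [mul_apply, diagonal_apply_eq] at h2
      have h3 : ∀ j, (star N) i j * N j i = ((‖N j i‖ ^ 2 : ℝ) : ℂ) := fun j => by
        rw [star_apply, Complex.star_def, ← Complex.normSq_eq_conj_mul_self,
          Complex.normSq_eq_norm_sq]
      simp only [h3] at h2
      rw [sq (p i)]
      exact_mod_cast h2
    have h4 : ‖N i i‖ ^ 2 ≤ p i ^ 2 := by
      rw [← h1]
      exact Finset.single_le_sum (f := fun j => ‖N j i‖ ^ 2) (fun _ _ => sq_nonneg _)
        (Finset.mem_univ i)
    exact (Complex.re_le_norm _).trans (le_of_sq_le_sq h4 (hp i))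
  have e1 : M.trace.re = ∑ i, (N i i).re := by
    rw [← trace_star_mul_mul hu' M, trace, Complex.re_sum]
    rfl
  have e2 : P.trace.re = ∑ i, p i := by
    rw [he, trace_mul_comm, ← mul_assoc, hu, one_mul, trace_diagonal, Complex.re_sum]
    rfl
  rw [e1, e2]
  exact Finset.sum_le_sum fun i _ => hNi i

/-- The Powers–Størmer inequality. -/
theorem exists_re_trace_sq_le {a b : Matrix ι ι ℂ} (ha : a.PosSemidef) (hb : b.PosSemidef) :
    ∃ S : Matrix ι ι ℂ, star S = S ∧ S * S = 1 ∧
      ((a - b) * (a - b)).trace.re ≤ (S * (a * a - b * b)).trace.re := by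
  have hd : (a - b).IsHermitian := ha.isHermitian.sub hb.isHermitian
  obtain ⟨u, hu, hu', he⟩ := exists_eq_unitary_mul_diagonal hd
  set l := hd.eigenvalues
  -- `S` is the sign of `a - b`; giving the kernel the sign `1` ensures `S * S = 1`.
  let s : ι → ℝ := fun i => if 0 ≤ l i then 1 else -1
  have hs : ∀ i, s i * s i = 1 := fun i => by simp only [s]; split_ifs <;> norm_num
  have hsl : ∀ i, s i * l i = |l i| := fun i => by
    simp only [s]
    split_ifs with h
    · rw [one_mul, abs_of_nonneg h]
    · rw [neg_one_mul, abs_of_neg (not_le.1 h)]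
  set D := diagonal (fun i => (l i : ℂ)) with hD
  set Q := diagonal (fun i => (s i : ℂ)) with hQd
  set a' := star u * a * u with ha'
  set b' := star u * b * u with hb'
  have hab : a' - b' = D := by
    calc a' - b' = star u * (a - b) * u := by simp only [ha', hb']; noncomm_ring
      _ = (star u * u) * D * (star u * u) := by rw [he]; noncomm_ring
      _ = D := by rw [hu]; simp
  have hapos : a'.PosSemidef := ha.conjTranspose_mul_mul_same u
  have hbpos : b'.PosSemidef := hb.conjTranspose_mul_mul_same u
  refine ⟨u * Q * star u, ?_, ?_, ?_⟩
  · have : star Q = Q := by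
      rw [hQd, star_eq_conjTranspose, diagonal_conjTranspose]
      congr 1
      ext i
      simp
    rw [star_mul, star_mul, star_star, this, mul_assoc]
  · calc _ = u * Q * (star u * u) * Q * star u := by noncomm_ring
      _ = u * (Q * Q) * star u := by rw [hu]; noncomm_ring
      _ = 1 := by
        have : Q * Q = 1 := by
          rw [hQd, diagonal_mul_diagonal, ← diagonal_one]
          congr 1
          ext i
          exact_mod_cast hs i
        rw [this, mul_one, hu']
  · have e1 : ((a - b) * (a - b)).trace = (D * D).trace := by
      rw [← trace_star_mul_mul hu', ← hab]
      congr 1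
      calc _ = star u * (a - b) * 1 * (a - b) * u := by noncomm_ring
        _ = _ := by rw [← hu', ha', hb']; noncomm_ring
    -- From `a² - b² = a(a - b) + (a - b)b`. It remains to compare diagonal entries: `|l i| = |a'ᵢᵢ
    -- - b'ᵢᵢ| ≤ a'ᵢᵢ + b'ᵢᵢ` by positivity.
    have e2 : (u * Q * star u * (a * a - b * b)).trace = (Q * (a' * D + D * b')).trace := by
      rw [← trace_star_mul_mul hu', ← hab]
      congr 1
      calc _ = (star u * u) * Q * (star u * (a * 1 * a - b * 1 * b) * u) := by noncomm_ring
        _ = Q * (star u * (a * (u * star u) * a - b * (u * star u) * b) * u) := by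
          rw [hu, one_mul, hu']
        _ = Q * (a' * a' - b' * b') := by rw [ha', hb']; noncomm_ring
        _ = _ := by noncomm_ring
    rw [e1, e2]
    simp only [trace, Complex.re_sum, diag_apply]
    refine Finset.sum_le_sum fun i _ => ?_
    have hi : (a' i i).re - (b' i i).re = l i := by
      rw [← Complex.sub_re, ← Matrix.sub_apply, hab, hD, diagonal_apply_eq, Complex.ofReal_re]
    have hai : 0 ≤ (a' i i).re := (Complex.le_def.1 (hapos.diag_nonneg (i := i))).1
    have hbi : 0 ≤ (b' i i).re := (Complex.le_def.1 (hbpos.diag_nonneg (i := i))).1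
    rw [hD, hQd, diagonal_mul_diagonal, diagonal_apply_eq, diagonal_mul, Matrix.add_apply, mul_diagonal,
      diagonal_mul, mul_comm (a' i i), ← mul_add, ← mul_assoc, ← Complex.ofReal_mul,
      ← Complex.ofReal_mul, Complex.ofReal_re, Complex.re_ofReal_mul, hsl, Complex.add_re,
      ← abs_mul_abs_self]
    refine mul_le_mul_of_nonneg_left ?_ (abs_nonneg _)
    rw [abs_le]
    constructor <;> linarith

/-- The lower Fuchs–van de Graaf inequality, tested with a single observable. -/
theorem exists_one_sub_le_fidelity {ρ σ : Matrix ι ι ℂ} (hρ : IsDensity ρ) (hσ : IsDensity σ) :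
    ∃ S : Matrix ι ι ℂ, star S = S ∧ S * S = 1 ∧
      1 - (S * (ρ - σ)).trace.re / 2 ≤ fidelity ρ σ := by
  set a := CFC.sqrt ρ
  set b := CFC.sqrt σ
  have ha : a.PosSemidef := nonneg_iff_posSemidef.1 (CFC.sqrt_nonneg _)
  have hb : b.PosSemidef := nonneg_iff_posSemidef.1 (CFC.sqrt_nonneg _)
  have haa : a * a = ρ := CFC.sqrt_mul_sqrt_self _ (nonneg_iff_posSemidef.2 hρ.1)
  have hbb : b * b = σ := CFC.sqrt_mul_sqrt_self _ (nonneg_iff_posSemidef.2 hσ.1)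
  obtain ⟨S, h1, h2, h3⟩ := exists_re_trace_sq_le ha hb
  refine ⟨S, h1, h2, ?_⟩
  -- With `a = √ρ` and `b = √σ`, the fidelity is the trace norm of `a * b`, while `tr (a - b)² = 2 -
  -- 2 Re tr (a * b)`.
  have h4 := re_trace_le_re_trace_sqrt (a * b)
  have e : star (a * b) * (a * b) = b * ρ * b := by
    rw [star_mul, show star a = a from ha.isHermitian, show star b = b from hb.isHermitian, ← haa]
    noncomm_ring
  rw [e] at h4
  have e2 : ((a - b) * (a - b)).trace.re = 2 - 2 * (a * b).trace.re := by
    have : (a - b) * (a - b) = ρ + σ - a * b - b * a := by rw [← haa, ← hbb]; noncomm_ring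
    rw [this, trace_sub, trace_sub, trace_add, hρ.2, hσ.2, trace_mul_comm b a]
    simp
    ring
  rw [e2, haa, hbb] at h3
  unfold fidelity
  linarith

end Fidelity

/-! ### Partial traces and detecting a local unitary -/

section Reduced

open Matrix

variable {V : Type*} [Fintype V] [DecidableEq V]
  {κ : V → Type*} [∀ v, Fintype (κ v)] [∀ v, DecidableEq (κ v)] (Y : Finset V)

/-- A configuration of the full system is one of `Y` together with one of its complement. -/
def configEquiv (κ : V → Type*) (Y : Finset V) :
    (∀ v, κ v) ≃ Config κ Y × (∀ v : {v // v ∉ Y}, κ v) :=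
  Equiv.piEquivPiSubtypeProd (· ∈ Y) κ

omit [∀ v, Fintype (κ v)] in
theorem embed_eq (A : Matrix (Config κ Y) (Config κ Y) ℂ) :
    embed Y A = (Matrix.kroneckerMap (· * ·) A (1 : Matrix (∀ v : {v // v ∉ Y}, κ v) _ ℂ)).submatrix
      (configEquiv κ Y) (configEquiv κ Y) := by
  ext σ τ
  simp only [embed, submatrix_apply, kroneckerMap_apply, one_apply, mul_ite, mul_one, mul_zero]
  refine if_congr ⟨fun h => funext fun v => h v v.2, fun h v hv => congrFun h ⟨v, hv⟩⟩ rfl rfl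

omit [∀ v, Fintype (κ v)] in
theorem embed_one : embed Y (1 : Matrix (Config κ Y) (Config κ Y) ℂ) = 1 := by
  rw [embed_eq, one_kronecker_one, submatrix_one_equiv]

theorem embed_mul (A B : Matrix (Config κ Y) (Config κ Y) ℂ) :
    embed Y (A * B) = embed Y A * embed Y B := by
  rw [embed_eq, embed_eq, embed_eq, submatrix_mul_equiv, ← mul_kronecker_mul, one_mul]

omit [∀ v, Fintype (κ v)] in
theorem embed_conjTranspose (A : Matrix (Config κ Y) (Config κ Y) ℂ) :
    embed Y Aᴴ = (embed Y A)ᴴ := by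
  rw [embed_eq, embed_eq, conjTranspose_submatrix, conjTranspose_kronecker, conjTranspose_one]

theorem reduced_eq (M : Op κ) :
    reduced Y M = ∑ c : ∀ v : {v // v ∉ Y}, κ v, M.submatrix
      (fun a => (configEquiv κ Y).symm (a, c)) (fun b => (configEquiv κ Y).symm (b, c)) := by
  ext a b
  have h : ∀ σ : ∀ v, κ v, ∀ a, (∀ v : Y, σ v = a v) ↔ (configEquiv κ Y σ).1 = a := fun σ a =>
    funext_iff.symm
  have h' : ∀ σ τ : ∀ v, κ v, (∀ v, v ∉ Y → σ v = τ v) ↔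
      (configEquiv κ Y σ).2 = (configEquiv κ Y τ).2 := fun σ τ =>
    ⟨fun h => funext fun v => h v v.2, fun h v hv => congrFun h ⟨v, hv⟩⟩
  simp only [reduced, h, h', Matrix.sum_apply, submatrix_apply]
  rw [← (configEquiv κ Y).symm.sum_comp]
  simp_rw [← (configEquiv κ Y).symm.sum_comp (fun τ => ite _ (M _ τ) 0)]
  simp only [Equiv.apply_symm_apply, Fintype.sum_prod_type, ite_and]
  simp

/-- The duality behind the partial trace: an observable on `Y` sees a state only through its
reduction. -/
theorem trace_embed_mul (A : Matrix (Config κ Y) (Config κ Y) ℂ) (M : Op κ) :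
    (embed Y A * M).trace = (A * reduced Y M).trace := by
  rw [reduced_eq, Matrix.mul_sum, trace_sum, trace, ← (configEquiv κ Y).symm.sum_comp,
    Fintype.sum_prod_type, Finset.sum_comm]
  refine Finset.sum_congr rfl fun c _ => Finset.sum_congr rfl fun a _ => ?_
  rw [diag_apply, diag_apply, mul_apply, mul_apply, ← (configEquiv κ Y).symm.sum_comp,
    Fintype.sum_prod_type]
  refine Finset.sum_congr rfl fun b _ => ?_
  rw [embed_eq]
  simp [one_apply]

theorem IsDensity.reduced {ρ : Op κ} (hρ : IsDensity ρ) : IsDensity (reduced Y ρ) := by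
  refine ⟨?_, ?_⟩
  · rw [reduced_eq]
    exact posSemidef_sum _ fun c _ => hρ.1.submatrix _
  · rw [← one_mul (SpinGraph.reduced Y ρ), ← trace_embed_mul, embed_one, one_mul, hρ.2]

theorem IsDensity.conj {ι : Type*} [Fintype ι] [DecidableEq ι] {ρ u : Matrix ι ι ℂ}
    (hρ : IsDensity ρ) (hu : u ∈ unitary (Matrix ι ι ℂ)) : IsDensity (u * ρ * uᴴ) := by
  refine ⟨hρ.1.mul_mul_conjTranspose_same u, ?_⟩
  rw [trace_mul_cycle, ← star_eq_conjTranspose, (Unitary.mem_iff.1 hu).1, one_mul, hρ.2]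

/-- Since `Q† [Q, E] = E - Q† E Q`, the change of an expectation value becomes a commutator. -/
theorem trace_mul_sub_conj {ι : Type*} [Fintype ι] [DecidableEq ι] {Q : Matrix ι ι ℂ}
    (hQ : star Q * Q = 1) (E ρ : Matrix ι ι ℂ) :
    (E * ρ).trace - (E * (Q * ρ * Qᴴ)).trace = (ρ * (star Q * ⁅Q, E⁆)).trace := by
  rw [Ring.lie_def, mul_sub, mul_sub, trace_sub, ← mul_assoc (star Q), hQ, one_mul,
    trace_mul_comm E ρ, ← star_eq_conjTranspose]
  congr 1
  rw [trace_mul_comm, mul_assoc, mul_assoc, trace_mul_comm]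
  simp only [mul_assoc]

/-- Acting with `A` before `T` amounts to acting with `T A T†` after it. -/
theorem conj_mul_conj {ι : Type*} [Fintype ι] [DecidableEq ι] {T : Matrix ι ι ℂ}
    (hT : Tᴴ * T = 1) (A ρ : Matrix ι ι ℂ) :
    T * A * ρ * Aᴴ * Tᴴ = (T * A * Tᴴ) * (T * ρ * Tᴴ) * (T * A * Tᴴ)ᴴ := by
  have h : ∀ M, Tᴴ * (T * M) = M := fun M => by rw [← mul_assoc, hT, one_mul]
  simp only [conjTranspose_mul, conjTranspose_conjTranspose, mul_assoc, h]

theorem norm_le_one_of_mem_unitary {A : Type*} [NormedRing A] [StarRing A] [CStarRing A] {u : A}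
    (hu : u ∈ unitary A) : ‖u‖ ≤ 1 := by
  -- If some `κ v` is empty, the operator algebra is zero and `‖1‖ = 0`.
  rcases subsingleton_or_nontrivial A with _ | _
  · rw [Subsingleton.elim u 0, norm_zero]
    exact zero_le_one
  · exact (CStarRing.norm_of_mem_unitary hu).le

variable {Y} {X : Finset V}

/-- A small commutator bound implies that a local unitary on `X` can hardly be detected on `Y`. -/
theorem IsCommutatorBound.one_sub_le_fidelity {T : Op κ} {c : ℝ} (hc : IsCommutatorBound T X Y c)
    (hc0 : 0 ≤ c) (hT : T ∈ unitary (Op κ)) {ρ A : Op κ} (hρ : IsDensity ρ) (hA : ActsOn X A)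
    (hAu : A ∈ unitary (Op κ)) :
    1 - c * ‖A‖ ≤ fidelity (reduced Y (T * ρ * Tᴴ)) (reduced Y (T * A * ρ * Aᴴ * Tᴴ)) := by
  have hρ' : IsDensity (T * ρ * Tᴴ) := hρ.conj hT
  set ρ' := T * ρ * Tᴴ with hρdef
  set Q := T * A * Tᴴ with hQ
  have hTT : Tᴴ * T = 1 := (Unitary.mem_iff.1 hT).1
  have hQu : Q ∈ unitary (Op κ) := mul_mem (mul_mem hT hAu) (Unitary.star_mem hT)
  have hQQ : star Q * Q = 1 := (Unitary.mem_iff.1 hQu).1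
  have e1 : T * A * ρ * Aᴴ * Tᴴ = Q * ρ' * Qᴴ := conj_mul_conj hTT A ρ
  rw [e1]
  obtain ⟨S, hS1, hS2, hS3⟩ := exists_one_sub_le_fidelity (hρ'.reduced Y) ((hρ'.conj hQu).reduced Y)
  set E : Op κ := embed Y S with hE
  have hEu : E ∈ unitary (Op κ) := by
    have h1 : star E = E := by
      rw [hE, star_eq_conjTranspose, ← embed_conjTranspose, ← star_eq_conjTranspose, hS1]
    have h2 : E * E = 1 := by rw [hE, ← embed_mul, hS2, embed_one]
    exact Unitary.mem_iff.2 ⟨by rw [h1, h2], by rw [h1, h2]⟩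
  have e2 : (S * (reduced Y ρ' - reduced Y (Q * ρ' * Qᴴ))).trace =
      (ρ' * (star Q * ⁅Q, E⁆)).trace := by
    rw [mul_sub, trace_sub, ← trace_embed_mul, ← trace_embed_mul, ← hE, trace_mul_sub_conj hQQ]
  have h4 : (S * (reduced Y ρ' - reduced Y (Q * ρ' * Qᴴ))).trace.re ≤ c * ‖A‖ := by
    rw [e2]
    refine (Complex.re_le_norm _).trans ((hρ'.norm_trace_mul_le _).trans ?_)
    rw [CStarRing.norm_mem_unitary_mul _ (Unitary.star_mem hQu)]
    refine (hc A E hA ⟨S, rfl⟩).trans ?_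
    exact mul_le_of_le_one_right (by positivity) (norm_le_one_of_mem_unitary hEu)
  have h5 : 0 ≤ c * ‖A‖ := by positivity
  linarith

end Reduced

/-! ### The Lieb–Robinson coefficient -/

section Coefficient

variable {V : Type*} [Fintype V] [DecidableEq V]
  {κ : V → Type*} [∀ v, Fintype (κ v)] [∀ v, DecidableEq (κ v)] {X Y : Finset V} {T : Op κ} {c : ℝ}

theorem isCommutatorBound_two (hT : T ∈ unitary (Op κ)) : IsCommutatorBound T X Y 2 := by
  intro A B _ _
  refine (norm_lie_le _ _).trans_eq ?_
  rw [← Matrix.star_eq_conjTranspose, norm_mul_mul_star_of_mem_unitary hT]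
  ring

/-- The commutator bounds form a closed set, bounded below and containing `2`, so the infimum is
attained. -/
theorem isCommutatorBound_lrCoeff (hT : T ∈ unitary (Op κ)) :
    IsCommutatorBound T X Y (lrCoeff T X Y) := by
  have hclosed : IsClosed {c : ℝ | 0 ≤ c ∧ IsCommutatorBound T X Y c} := by
    simp only [IsCommutatorBound, Set.ofPred_and, Set.ofPred_forall]
    refine isClosed_Ici.inter ?_
    refine isClosed_iInter fun A => isClosed_iInter fun B => isClosed_iInter fun _ =>
      isClosed_iInter fun _ => isClosed_le continuous_const (by fun_prop)
  exact (hclosed.csInf_mem ⟨2, zero_le_two, isCommutatorBound_two hT⟩ ⟨0, fun c hc => hc.1⟩).2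

theorem IsCommutatorBound.lrCoeff_le (hc : IsCommutatorBound T X Y c) (hc0 : 0 ≤ c) :
    lrCoeff T X Y ≤ c :=
  csInf_le ⟨0, fun _ h => h.1⟩ ⟨hc0, hc⟩

theorem IsCommutatorBound.mono (hc : IsCommutatorBound T X Y c) {X' : Finset V} (hX : X' ⊆ X)
    {c' : ℝ} (hcc' : c ≤ c') : IsCommutatorBound T X' Y c' := by
  intro A B hA hB
  refine (hc A B (hA.mono hX) hB).trans ?_
  gcongr

theorem norm_lie_comm {A : Type*} [NormedRing A] (a b : A) : ‖⁅a, b⁆‖ = ‖⁅b, a⁆‖ := by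
  rw [Ring.lie_def, Ring.lie_def, norm_sub_rev]

/-- Passing to the inverse dynamics exchanges the two regions. -/
theorem IsCommutatorBound.conjTranspose (hT : T ∈ unitary (Op κ)) (hc : IsCommutatorBound T X Y c) :
    IsCommutatorBound Tᴴ Y X c := by
  intro A B hA hB
  have h1 := (Unitary.mem_iff.1 hT).2
  have e : T * ⁅Tᴴ * A * T, B⁆ * star T = ⁅A, T * B * Tᴴ⁆ := by
    have h : ∀ M, T * (Tᴴ * M) = M := fun M => by
      rw [← mul_assoc, ← Matrix.star_eq_conjTranspose, h1, one_mul]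
    rw [Ring.lie_def, Ring.lie_def, mul_sub, sub_mul]
    simp only [Matrix.star_eq_conjTranspose, mul_assoc, h]
    rw [show T * Tᴴ = 1 from h1, mul_one]
  rw [Matrix.conjTranspose_conjTranspose, ← norm_mul_mul_star_of_mem_unitary hT, e, norm_lie_comm]
  exact (hc B A hB hA).trans_eq (by ring)

end Coefficient

/-! ### Exponential tails and the Bessel series -/

section Series

theorem summable_pow_div_factorial_mul {w : ℕ → ℕ} {C d : ℕ} (hw : ∀ n, w n ≤ C * d ^ n) {x : ℝ}
    (hx : 0 ≤ x) : Summable fun n : ℕ => x ^ n / (n ! : ℝ) * w n := by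
  refine Summable.of_nonneg_of_le (fun n => by positivity) (fun n => ?_)
    ((Real.summable_pow_div_factorial (x * d)).mul_left (C : ℝ))
  have h1 : (w n : ℝ) ≤ C * d ^ n := by exact_mod_cast hw n
  calc x ^ n / (n ! : ℝ) * w n ≤ x ^ n / (n ! : ℝ) * (C * d ^ n) := by gcongr
    _ = _ := by rw [mul_pow]; ring

theorem tsum_pow_div_factorial_mul_le {w : ℕ → ℕ} {C d : ℕ} (hw : ∀ n, w n ≤ C * d ^ n) {x : ℝ}
    (hx : 0 ≤ x) (R : ℕ) :
    ∑' n : ℕ, x ^ (R + n) / ((R + n)! : ℝ) * w (R + n) ≤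
      C * Real.exp (Real.exp 1 * d * x - R) := by
  have hs := summable_pow_div_factorial_mul hw hx
  set y : ℝ := Real.exp 1 * d * x with hy
  have hy0 : 0 ≤ y := by positivity
  have hE : HasSum (fun n : ℕ => y ^ n / (n ! : ℝ)) (Real.exp y) := by
    rw [Real.exp_eq_exp_ℝ]
    exact NormedSpace.expSeries_div_hasSum_exp y
  have h1 : ∀ n : ℕ, x ^ (R + n) / ((R + n)! : ℝ) * w (R + n) ≤
      C * Real.exp (-R) * (y ^ (R + n) / ((R + n)! : ℝ)) := fun n => by
    have h2 : (w (R + n) : ℝ) ≤ C * d ^ (R + n) := by exact_mod_cast hw (R + n)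
    -- Each tail term may be multiplied by `e^n ≥ 1`, written as `e^(-R) e^(R+n)`; the second factor
    -- is absorbed into the power.
    have h3 : (1 : ℝ) ≤ Real.exp (-R) * Real.exp 1 ^ (R + n) := by
      rw [← Real.exp_nat_mul, ← Real.exp_add]
      refine Real.one_le_exp ?_
      push_cast
      linarith [(Nat.cast_nonneg n : (0 : ℝ) ≤ n)]
    calc x ^ (R + n) / ((R + n)! : ℝ) * w (R + n)
        ≤ x ^ (R + n) / ((R + n)! : ℝ) * (C * d ^ (R + n)) * 1 := by
          rw [mul_one]; gcongr
      _ ≤ x ^ (R + n) / ((R + n)! : ℝ) * (C * d ^ (R + n)) *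
            (Real.exp (-R) * Real.exp 1 ^ (R + n)) := by gcongr
      _ = _ := by rw [hy, mul_pow, mul_pow]; ring
  have hshift : ∀ {f : ℕ → ℝ}, Summable f → Summable fun n => f (R + n) := fun hf =>
    hf.comp_injective (add_right_injective R)
  calc _ ≤ ∑' n : ℕ, C * Real.exp (-R) * (y ^ (R + n) / ((R + n)! : ℝ)) :=
        (hshift hs).tsum_le_tsum h1 ((hshift hE.summable).mul_left _)
    _ = C * Real.exp (-R) * ∑' n : ℕ, (y ^ (R + n) / ((R + n)! : ℝ)) := tsum_mul_left
    _ ≤ C * Real.exp (-R) * Real.exp y := by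
        gcongr
        rw [← hE.tsum_eq]
        exact tsum_comp_le_tsum_of_inj hE.summable (fun n => by positivity)
          (add_right_injective R)
    _ = _ := by rw [mul_assoc, ← Real.exp_add, neg_add_eq_sub]

/-- If the coefficients below `R` vanish, the truncated series is bounded by the tail from `R`. -/
theorem sum_le_tsum_tail {f : ℕ → ℝ} (hf : Summable f) (hf0 : ∀ n, 0 ≤ f n) {R : ℕ}
    (hR : ∀ n < R, f n = 0) (m : ℕ) :
    ∑ n ∈ Finset.range m, f (n + 1) ≤ ∑' n, f (R + n) := by
  have h1 : ∑' n, f (R + n) = ∑' n, f n := by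
    rw [← hf.sum_add_tsum_nat_add R,
      Finset.sum_eq_zero fun n hn => hR n (Finset.mem_range.1 hn), zero_add]
    simp only [add_comm]
  have h2 := Finset.sum_range_succ' f m
  rw [h1]
  linarith [hf0 0, hf.sum_le_tsum (Finset.range (m + 1)) fun n _ => hf0 n]

theorem summable_besselI (n : ℕ) (x : ℝ) :
    Summable fun k : ℕ => (x / 2) ^ (2 * k + n) / ((k ! : ℝ) * ((k + n)! : ℝ)) := by
  have h := ((Real.summable_pow_div_factorial (|x / 2| ^ 2)).mul_left (|x / 2| ^ n))
  refine Summable.of_norm_bounded h fun k => ?_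
  rw [norm_div, norm_pow, Real.norm_eq_abs, Real.norm_of_nonneg (by positivity), pow_add, pow_mul,
    mul_comm, mul_div_assoc]
  have h1 : (1 : ℝ) ≤ ((k + n)! : ℝ) := by exact_mod_cast Nat.factorial_pos _
  gcongr
  exact le_mul_of_one_le_right (by positivity) h1

/-- The factorial of `R + 2k` cancels against the binomial coefficient, leaving `1 / (k! (R + k)!)`.
-/
theorem hasSum_besselI (R : ℕ) (x : ℝ) :
    HasSum (fun k : ℕ => (2 * x) ^ (R + 2 * k) / ((R + 2 * k)! : ℝ) *
      ((R + 2 * k).choose (R + k) : ℝ)) (besselI R (4 * x)) := by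
  have h : HasSum _ (besselI R (4 * x)) := (summable_besselI R (4 * x)).hasSum
  convert h using 2 with k
  have h1 := Nat.choose_mul_factorial_mul_factorial (show R + k ≤ R + 2 * k by omega)
  rw [show R + 2 * k - (R + k) = k by omega] at h1
  have h2 : ((R + 2 * k).choose (R + k) : ℝ) * (R + k)! * k ! = (R + 2 * k)! := by exact_mod_cast h1
  have h3 : ((R + 2 * k).choose (R + k) : ℝ) ≠ 0 := by
    exact_mod_cast (Nat.choose_pos (by omega)).ne'
  rw [← h2, show 4 * x / 2 = 2 * x by ring, add_comm (2 * k) R, add_comm k R]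
  have := Nat.cast_ne_zero (R := ℝ).2 (Nat.factorial_ne_zero k)
  have := Nat.cast_ne_zero (R := ℝ).2 (Nat.factorial_ne_zero (R + k))
  field_simp

theorem pow_div_factorial_le_besselI (R : ℕ) {x : ℝ} (hx : 0 ≤ x) :
    (2 * x) ^ R / (R ! : ℝ) ≤ besselI R (4 * x) := by
  have h := hasSum_besselI R x
  have := h.summable.le_tsum 0 fun k _ => by positivity
  rw [h.tsum_eq] at this
  simpa using this

end Series

/-! ### Geometry of the linear chain -/

section Line

variable {V : Type*} {G : SimpleGraph V}

theorem regionDist_comm (G : SimpleGraph V) (X Y : Finset V) :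
    regionDist G X Y = regionDist G Y X := by
  simp only [regionDist]
  rw [iInf₂_comm]
  simp only [SimpleGraph.edist_comm]

theorem abs_sub_le_length {g : V → ℤ}
    (hadj : ∀ x z, G.Adj x z → g z = g x + 1 ∨ g x = g z + 1) {x y : V} (p : G.Walk x y) :
    |g x - g y| ≤ p.length := by
  induction p with
  | nil => simp
  | cons h p ih =>
    have := hadj _ _ h
    rw [SimpleGraph.Walk.length_cons]
    push_cast
    rw [abs_le] at ih ⊢
    omega

/-- The vertices of a linear chain carry integer positions that measure the distance. -/
theorem IsLinearChain.exists_position (hG : IsLinearChain G) :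
    ∃ g : V → ℤ, Function.Injective g ∧
      (∀ x z, G.Adj x z → g z = g x + 1 ∨ g x = g z + 1) ∧
      ∀ x y, G.edist x y = (g x - g y).natAbs := by
  obtain ⟨L, ⟨f⟩⟩ := hG
  have hadj : ∀ x z, G.Adj x z → ((f z).1 : ℤ) = (f x).1 + 1 ∨ ((f x).1 : ℤ) = (f z).1 + 1 := by
    intro x z hxz
    have := SimpleGraph.pathGraph_adj.1 (f.map_adj_iff.2 hxz)
    omega
  have hle : ∀ x y, f x ≤ f y → G.edist x y ≤ ((f y).1 - (f x).1 : ℕ) := fun x y h => by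
    obtain ⟨n, hn⟩ := Nat.exists_eq_add_of_le (show (f x).1 ≤ (f y).1 from h)
    rw [hn, add_tsub_cancel_left]
    clear h
    induction n generalizing y with
    | zero =>
      have : x = y := f.injective (Fin.ext hn.symm)
      simp [this]
    | succ n ih =>
      have hk : (f x).1 + n < L := by have := (f y).2; omega
      obtain ⟨z, hz⟩ := f.surjective ⟨(f x).1 + n, hk⟩
      have hzy : G.Adj z y := f.map_adj_iff.1 (SimpleGraph.pathGraph_adj.2 (Or.inl (by
        rw [hz, hn]; rfl)))
      have h3 := SimpleGraph.edist_triangle (G := G) (u := x) (v := z) (w := y)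
      rw [SimpleGraph.edist_eq_one_iff_adj.2 hzy] at h3
      exact h3.trans (add_le_add_left (ih z (by rw [hz])) 1)
  refine ⟨fun v => ((f v).1 : ℤ), fun x y h => f.injective (Fin.ext (by simpa using h)), hadj, ?_⟩
  intro x y
  apply le_antisymm
  · rcases le_total (f x) (f y) with h | h
    · refine (hle x y h).trans_eq ?_
      have : (f x).1 ≤ (f y).1 := h
      norm_cast
      dsimp only
      omega
    · rw [SimpleGraph.edist_comm]
      refine (hle y x h).trans_eq ?_
      have : (f y).1 ≤ (f x).1 := h
      norm_cast
      dsimp only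
      omega
  -- Conversely, a walk moves the position by one unit per step, so it cannot be shorter than the
  -- difference of positions.
  · refine le_iInf fun p => ?_
    have := abs_le.1 (abs_sub_le_length hadj p)
    norm_cast
    dsimp only
    omega

end Line

/-! ### The bounds for general graphs and for chains -/

section Bounds

variable {V : Type*} [Fintype V] [DecidableEq V] {G : SimpleGraph V} [DecidableRel G.Adj]
  {κ : V → Type*} [∀ v, Fintype (κ v)] [∀ v, DecidableEq (κ v)] {B J : ℝ}
  {h : LocalHamiltonian G κ B J} {X Y : Finset V} {t : ℝ} {U : ℝ → Op κ} {R : ℕ}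

theorem IsEvolution.isCommutatorBound_tsum (hJ : 0 ≤ J) (hXY : Disjoint X Y)
    (hU : IsEvolution h.H U) (ht : 0 ≤ t) (hR : (R : ℕ∞) ≤ regionDist G X Y) :
    IsCommutatorBound (U t) X Y
      (2 * ∑' n : ℕ, (2 * J * t) ^ (R + n) / ((R + n)! : ℝ) * pathCount G X Y (R + n)) := by
  refine (hU.isCommutatorBound_escape hJ hXY ht).mono subset_rfl ?_
  refine mul_le_mul_of_nonneg_left ?_ zero_le_two
  refine le_trans (Finset.sum_le_sum fun n _ => ?_) (sum_le_tsum_tail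
    (summable_pow_div_factorial_mul (pathCount_le G X Y) (by positivity : 0 ≤ 2 * J * t))
    (fun n => by positivity) (fun n hn => by simp [pathCount_eq_zero G hR hn]) _)
  have := escapeCount_le G X Y n
  gcongr

/-- Commutator bounds pass to smaller regions, so `X` may be replaced by the whole half-line up to
`x₀`. This removes all walks but the direct one, and with them all terms but one. -/
theorem IsEvolution.isCommutatorBound_line (hJ : 0 ≤ J) (hU : IsEvolution h.H U) (ht : 0 ≤ t)
    {g : V → ℤ} (hg : Function.Injective g)
    (hadj : ∀ x z, G.Adj x z → g z = g x + 1 ∨ g x = g z + 1) {x₀ y₀ : V} (hy₀ : y₀ ∈ Y)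
    (hX : ∀ x ∈ X, g x ≤ g x₀) (hY : ∀ y ∈ Y, g y₀ ≤ g y) (hR : 0 < R)
    (hxy : g x₀ + R = g y₀) :
    IsCommutatorBound (U t) X Y (2 * ((2 * J * t) ^ R / (R ! : ℝ))) := by
  have hdisj : Disjoint ({v | g v ≤ g x₀} : Finset V) Y := by
    rw [Finset.disjoint_left]
    intro v hv hvY
    have := hY v hvY
    simp only [Finset.mem_filter, Finset.mem_univ, true_and] at hv
    omega
  refine (hU.isCommutatorBound_escape hJ hdisj ht).mono (fun x hx => by simpa using hX x hx) ?_
  refine mul_le_mul_of_nonneg_left ?_ zero_le_two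
  obtain ⟨r, rfl⟩ := Nat.exists_eq_succ_of_ne_zero hR.ne'
  have h0 : 0 ≤ (2 * J * t) ^ (r + 1) / ((r + 1)! : ℝ) := by positivity
  calc _ ≤ ∑ n ∈ Finset.range (Fintype.card V),
          if n = r then (2 * J * t) ^ (r + 1) / ((r + 1)! : ℝ) else 0 := by
        refine Finset.sum_le_sum fun n _ => ?_
        have hc := escapeCount_line_le hg hadj hy₀ hY (x₀ := x₀) (by omega) n
        by_cases hn : n = r
        · subst hn
          rw [if_pos rfl]
          have h1 : (escapeCount G {v | g v ≤ g x₀} Y n : ℝ) ≤ 1 := by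
            exact_mod_cast hc.trans (by split_ifs <;> simp)
          exact mul_le_of_le_one_right h0 h1
        · rw [if_neg (by push_cast at hxy; omega), Nat.le_zero] at hc
          rw [hc, if_neg hn, Nat.cast_zero, mul_zero]
    _ ≤ _ := by
        rw [Finset.sum_ite_eq']
        split_ifs
        exacts [le_rfl, h0]

theorem IsEvolution.isCommutatorBound_besselI (hJ : 0 ≤ J) (hU : IsEvolution h.H U) (ht : 0 ≤ t)
    (hG : IsLinearChain G) (hR : regionDist G X Y = R) (hX : regionDiam G X < R)
    (hY : regionDiam G Y < R) : IsCommutatorBound (U t) X Y (2 * besselI R (4 * J * t)) := by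
  obtain ⟨g, hg, hadj, hdist⟩ := hG.exists_position
  have hle : ∀ x ∈ X, ∀ y ∈ Y, R ≤ (g x - g y).natAbs := fun x hx y hy => by
    have : (R : ℕ∞) ≤ G.edist x y := hR ▸ (iInf₂_le x hx).trans (iInf₂_le y hy)
    rw [hdist] at this
    exact_mod_cast this
  have hdiam : ∀ {Z : Finset V}, regionDiam G Z < R → ∀ x ∈ Z, ∀ y ∈ Z, (g x - g y).natAbs < R := by
    intro Z hZ x hx y hy
    have : G.edist x y < R := lt_of_le_of_lt
      ((le_iSup₂ (f := fun y (_ : y ∈ Z) => G.edist x y) y hy).trans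
        (le_iSup₂ (f := fun x (_ : x ∈ Z) => ⨆ y ∈ Z, G.edist x y) x hx)) hZ
    rw [hdist] at this
    exact_mod_cast this
  have hX' := hdiam hX
  have hY' := hdiam hY
  -- The distance is finite, so being less than `R + 1` produces a closest pair.
  obtain ⟨x₀, hx₀, y₀, hy₀, hxy⟩ : ∃ x ∈ X, ∃ y ∈ Y, (g x - g y).natAbs = R := by
    have h1 : regionDist G X Y < (R + 1 : ℕ) := by rw [hR]; exact_mod_cast R.lt_succ_self
    simp only [regionDist, iInf_lt_iff] at h1
    obtain ⟨x, hx, y, hy, hlt⟩ := h1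
    rw [hdist] at hlt
    have hlt : (g x - g y).natAbs < R + 1 := by exact_mod_cast hlt
    exact ⟨x, hx, y, hy, le_antisymm (Nat.lt_succ_iff.1 hlt) (hle x hx y hy)⟩
  have hR0 : 0 < R := (Nat.zero_le _).trans_lt (hX' x₀ hx₀ x₀ hx₀)
  have hbound : IsCommutatorBound (U t) X Y (2 * ((2 * J * t) ^ R / (R ! : ℝ))) := by
    -- A vertex of `X` beyond `y₀` would be at least `R` from `y₀`, hence at least `2R` from `x₀`,
    -- contradicting `diam X < R`. So `X` lies behind `x₀`, and likewise `Y` beyond `y₀`. The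
    -- opposite order reduces to this one by the reflection `-g`.
    rcases le_total (g x₀) (g y₀) with hlt | hlt
    · refine hU.isCommutatorBound_line hJ ht hg hadj (x₀ := x₀) hy₀ (fun x hx => ?_)
        (fun y hy => ?_) hR0 (by omega)
      · have := hle x hx y₀ hy₀
        have := hX' x hx x₀ hx₀
        omega
      · have := hle x₀ hx₀ y hy
        have := hY' y hy y₀ hy₀
        omega
    · refine hU.isCommutatorBound_line hJ ht (g := fun v => -g v) (fun x y he => hg (neg_inj.1 he))
        (fun x z hxz => ?_) (x₀ := x₀) hy₀ (fun x hx => ?_) (fun y hy => ?_) hR0 (by omega)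
      · have := hadj x z hxz
        omega
      · have := hle x hx y₀ hy₀
        have := hX' x hx x₀ hx₀
        omega
      · have := hle x₀ hx₀ y hy
        have := hY' y hy y₀ hy₀
        omega
  refine hbound.mono subset_rfl (mul_le_mul_of_nonneg_left ?_ zero_le_two)
  have := pow_div_factorial_le_besselI R (mul_nonneg hJ ht)
  rwa [← mul_assoc, ← mul_assoc] at this

end Bounds

end SpinGraph

/-! ### The theorem, in both pictures -/

open SpinGraph in
theorem mainTheorem6 {V : Type*} [Fintype V] [DecidableEq V]
    (G : SimpleGraph V) [DecidableRel G.Adj]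
    {κ : V → Type*} [∀ v, Fintype (κ v)] [∀ v, DecidableEq (κ v)]
    {B J : ℝ} (hJ : 0 ≤ J) (h : LocalHamiltonian G κ B J)
    (U : ℝ → Op κ) (hU : IsEvolution h.H U) (t : ℝ) (ht : 0 ≤ t)
    -- `c_t` is taken in either picture: `O ↦ U_t O U_t†` or `O ↦ U_t† O U_t`
    (T : Op κ) (hT : T = U t ∨ T = (U t)ᴴ)
    (X Y : Finset V) (hXY : Disjoint X Y) (R : ℕ) :
    -- the coefficient `c_t(X,Y)` does bound the commutators
    IsCommutatorBound T X Y (lrCoeff T X Y) ∧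
    -- arbitrary graphs, regions at distance (at least) `R`
    ((R : ℕ∞) ≤ regionDist G X Y →
      (Summable fun n : ℕ => (2 * J * t) ^ (R + n) / ((R + n)! : ℝ) * pathCount G X Y (R + n)) ∧
      lrCoeff T X Y ≤
        2 * ∑' n : ℕ, (2 * J * t) ^ (R + n) / ((R + n)! : ℝ) * pathCount G X Y (R + n) ∧
      2 * ∑' n : ℕ, (2 * J * t) ^ (R + n) / ((R + n)! : ℝ) * pathCount G X Y (R + n) ≤
        2 * (X.card : ℝ) * Real.exp (2 * Real.exp 1 * G.maxDegree * J * t - R) ∧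
      lrCoeff T X Y ≤
        2 * (X.card : ℝ) * Real.exp (2 * Real.exp 1 * G.maxDegree * J * t - R) ∧
      ∀ ρ A : Op κ, IsDensity ρ → ActsOn X A → A ∈ Matrix.unitaryGroup (∀ v, κ v) ℂ →
        1 - 2 * (X.card : ℝ) * Real.exp (2 * Real.exp 1 * G.maxDegree * J * t - R) * ‖A‖ ≤
          fidelity (reduced Y (T * ρ * Tᴴ)) (reduced Y (T * A * ρ * Aᴴ * Tᴴ))) ∧
    -- linear chains
    (IsLinearChain G → regionDist G X Y = R → regionDiam G X < R → regionDiam G Y < R →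
      HasSum (fun k : ℕ => (2 * J * t) ^ (R + 2 * k) / ((R + 2 * k)! : ℝ) *
        ((R + 2 * k).choose (R + k) : ℝ)) (besselI R (4 * J * t)) ∧
      lrCoeff T X Y ≤ 2 * besselI R (4 * J * t) ∧
      ∀ ρ A : Op κ, IsDensity ρ → ActsOn X A → A ∈ Matrix.unitaryGroup (∀ v, κ v) ℂ →
        1 - 2 * besselI R (4 * J * t) * ‖A‖ ≤
          fidelity (reduced Y (T * ρ * Tᴴ)) (reduced Y (T * A * ρ * Aᴴ * Tᴴ))) := by
  have hU' : IsEvolution (h.outside ∅) U := h.outside_empty ▸ hU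
  have hUt : U t ∈ unitary (Op κ) := hU'.mem_unitary ht
  have hTu : T ∈ unitary (Op κ) := by
    rcases hT with rfl | rfl
    exacts [hUt, Unitary.star_mem hUt]
  have hJt : 0 ≤ 2 * J * t := by positivity
  refine ⟨isCommutatorBound_lrCoeff hTu, fun hR => ?_, fun hG hR hX hY => ?_⟩
  · have hbound : IsCommutatorBound T X Y
        (2 * ∑' n : ℕ, (2 * J * t) ^ (R + n) / ((R + n)! : ℝ) * pathCount G X Y (R + n)) := by
      rcases hT with rfl | rfl
      · exact hU.isCommutatorBound_tsum hJ hXY ht hR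
      -- The adjoint dynamics uses the bound for `U t` with the regions exchanged. Reversing walks
      -- shows that the count is symmetric, so the factor `|X|` is kept.
      · simp only [pathCount_comm G X Y]
        exact (hU.isCommutatorBound_tsum hJ hXY.symm ht
          (regionDist_comm G X Y ▸ hR)).conjTranspose hUt
    have h0 : 0 ≤ 2 * ∑' n : ℕ,
        (2 * J * t) ^ (R + n) / ((R + n)! : ℝ) * pathCount G X Y (R + n) :=
      mul_nonneg zero_le_two (tsum_nonneg fun n => by positivity)
    have hexp : 2 * ∑' n : ℕ, (2 * J * t) ^ (R + n) / ((R + n)! : ℝ) * pathCount G X Y (R + n) ≤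
        2 * (X.card : ℝ) * Real.exp (2 * Real.exp 1 * G.maxDegree * J * t - R) := by
      have := tsum_pow_div_factorial_mul_le (pathCount_le G X Y) hJt R
      rw [show 2 * Real.exp 1 * G.maxDegree * J * t =
        Real.exp 1 * G.maxDegree * (2 * J * t) by ring,
        mul_assoc 2 (X.card : ℝ)]
      exact mul_le_mul_of_nonneg_left this zero_le_two
    refine ⟨?_, hbound.lrCoeff_le h0, hexp, (hbound.lrCoeff_le h0).trans hexp,
      fun ρ A hρ hA hAu => ?_⟩
    · exact (summable_pow_div_factorial_mul (pathCount_le G X Y) hJt).comp_injective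
        (add_right_injective R)
    · exact (hbound.mono subset_rfl hexp).one_sub_le_fidelity (h0.trans hexp) hTu hρ hA hAu
  · have hbound : IsCommutatorBound T X Y (2 * besselI R (4 * J * t)) := by
      rcases hT with rfl | rfl
      · exact hU.isCommutatorBound_besselI hJ ht hG hR hX hY
      · exact (hU.isCommutatorBound_besselI hJ ht hG
          (regionDist_comm G X Y ▸ hR) hY hX).conjTranspose hUt
    have h0 : 0 ≤ 2 * besselI R (4 * J * t) :=
      mul_nonneg zero_le_two (tsum_nonneg fun k => by positivity)
    refine ⟨?_, hbound.lrCoeff_le h0, fun ρ A hρ hA hAu =>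
      hbound.one_sub_le_fidelity h0 hTu hρ hA hAu⟩
    have := hasSum_besselI R (J * t)
    simpa only [← mul_assoc] using this
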